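/- **Definitions.** For $k,l\in\mathbb N_0$, let $P^{\circ\bullet}(k,l)$ be the set of two-colored partitions: $k$ upper and $l$ lower points, each white ($\circ$) or black ($\bullet$), together with a decomposition of the $k+l$ points into blocks. A partition is noncrossing if its blocks can be drawn by strings without crossings in the strip between the two lines. The tensor product $p\otimes q$ is horizontal concatenation; the composition $pq$ (formed if the lower points of $q$ agree in number and colors with the upper points of $p$) is vertical concatenation, after which the middle points are removed; the involution $p^*$ is reflection at the horizontal axis. A category of partitions is a collection of subsets $\mathcal C(k,l)\subseteq P^{\circ\bullet}(k,l)$ ($k,l\in\mathbb N_0$) that is closed under tensor product, composition and involution and contains the two bicolored pair partitions in $P^{\circ\bullet}(0,2)$ (colors $\circ\bullet$ and $\bullet\circ$) and the two identity partitions in $P^{\circ\bullet}(1,1)$ (one block connecting an upper and a lower point of the same color). $\langle p_1,\dots,p_n\rangle$ denotes the smallest category containing $p_1,\dots,p_n$. Partitions without upper points are used as follows. $\sqcap_{\circ\circ}$ and $\sqcap_{\bullet\bullet}$ are the unicolored pair partitions in $P^{\circ\bullet}(0,2)$; $\uparrow_\circ$ and $\uparrow_\bullet$ are the singletons in $P^{\circ\bullet}(0,1)$;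 $\pi_{\circ\bullet\circ\bullet}\in P^{\circ\bullet}(0,4)$ is the single block on four points of colors $\circ\bullet\circ\bullet$; $b_k\in P^{\circ\bullet}(0,k)$ is the single block on $k$ white points; $\rho\in P^{\circ\bullet}(0,4)$ has colors $\circ\circ\bullet\bullet$ and blocks $\{1\},\{2,4\},\{3\}$. Zeroth tensor powers and $b_0$ are the empty partition. A category $\mathcal C$ is globally colorized if $\sqcap_{\circ\circ}\otimes\sqcap_{\bullet\bullet}\in\mathcal C$. It is in case $\mathcal O$ if it contains neither $\uparrow_\circ\otimes\uparrow_\bullet$ nor $\pi_{\circ\bullet\circ\bullet}$, in case $\mathcal H$ if it contains only the second of them, in case $\mathcal B$ if it contains only the first, and in case $\mathcal S$ if it contains both. **Theorem.** Let $\mathcal C$ be a globally colorized category of noncrossing two-colored partitions. Then $\mathcal C$ coincides with one of the following categories. * In case $\mathcal O$: $\mathcal O_{\rm glob}(k)=\langle \sqcap_{\circ\circ}^{\otimes k/2},\ \sqcap_{\circ\circ}\otimes\sqcap_{\bullet\bullet}\rangle$ for some $k\in 2\mathbb N_0$. * In case $\mathcal H$: $\mathcal H_{\rm glob}(k)=\langle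 b_k,\ \pi_{\circ\bullet\circ\bullet},\ \sqcap_{\circ\circ}\otimes\sqcap_{\bullet\bullet}\rangle$ for some $k\in 2\mathbb N_0$. * In case $\mathcal S$: $\mathcal S_{\rm glob}(k)=\langle \uparrow_\circ^{\otimes k},\ \pi_{\circ\bullet\circ\bullet},\ \uparrow_\circ\otimes\uparrow_\bullet,\ \sqcap_{\circ\circ}\otimes\sqcap_{\bullet\bullet}\rangle$ for some $k\in\mathbb N_0$. * In case $\mathcal B$: $\mathcal B_{\rm glob}(k)=\langle \uparrow_\circ^{\otimes k},\ \uparrow_\circ\otimes\uparrow_\bullet,\ \sqcap_{\circ\circ}\otimes\sqcap_{\bullet\bullet}\rangle$ for some $k\in 2\mathbb N_0$, or $\mathcal B'_{\rm glob}(k)=\langle \uparrow_\circ^{\otimes k},\ \rho,\ \uparrow_\circ\otimes\uparrow_\bullet,\ \sqcap_{\circ\circ}\otimes\sqcap_{\bullet\bullet}\rangle$ for some $k\in\mathbb N_0$. -/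

import Mathlib

namespace TwoColored

/-- The two colors of points. -/
inductive Color where
  | white
  | black
  deriving DecidableEq

open Color

/-- A two-colored partition with `k` upper and `l` lower points, both lines numbered from left to
right: a coloring of the points and a decomposition of the point set into blocks, given as the
equivalence relation of lying in the same block. -/
@[ext]
structure ColPart (k l : ℕ) where
  /-- colors of the upper points -/
  upper : Fin k → Color
  /-- colors of the lower points -/
  lower : Fin l → Color
  /-- two points are related iff they belong to the same block -/
  blocks : Setoid (Fin k ⊕ Fin l)

/-- The disjoint union of two equivalence relations: points of different summands are never
related. -/
def sumSetoid {α β : Type} (r : Setoid α) (s : Setoid β) : Setoid (α ⊕ β) where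
  r := Sum.LiftRel r s
  iseqv :=
    { refl := fun x => by
        cases x with
        | inl a => exact Sum.LiftRel.inl (r.refl a)
        | inr b => exact Sum.LiftRel.inr (s.refl b)
      symm := fun h => by
        cases h with
        | inl h => exact Sum.LiftRel.inl (r.symm h)
        | inr h => exact Sum.LiftRel.inr (s.symm h)
      trans := fun h h' => by
        cases h with
        | inl h => cases h' with
          | inl h' => exact Sum.LiftRel.inl (r.trans h h')
        | inr h => cases h' with
          | inr h' => exact Sum.LiftRel.inr (s.trans h h') }

namespace ColPart

variable {k l m k' l' : ℕ}

/-- Position of a point on one line when all upper points are rotated, one after the other, to the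
left of the lower points: the upper points from right to left, then the lower points from left to
right. -/
def pos : Fin k ⊕ Fin l → Fin (k + l) :=
  Sum.elim (fun i => Fin.castAdd l i.rev) (fun j => Fin.natAdd k j)

/-- A partition is noncrossing if, in the order of the points around the boundary of the strip
between the two lines, there are no `a < b < c < d` with `a, c` in one block and `b, d` in another
block. -/
def IsNoncrossing (p : ColPart k l) : Prop :=
  ∀ a b c d : Fin k ⊕ Fin l, pos a < pos b → pos b < pos c → pos c < pos d →
    p.blocks a c → p.blocks b d → p.blocks a b

/-- The points of a horizontal concatenation, sorted into the points of the left part and the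
points of the right part. -/
def split : Fin (k + k') ⊕ Fin (l + l') → (Fin k ⊕ Fin l) ⊕ (Fin k' ⊕ Fin l') :=
  Sum.elim
    (fun i => Sum.map Sum.inl Sum.inl (finSumFinEquiv.symm i))
    (fun j => Sum.map Sum.inr Sum.inr (finSumFinEquiv.symm j))

/-- The tensor product `p ⊗ q`: `p` and `q` side by side, `p` on the left. -/
def tensor (p : ColPart k l) (q : ColPart k' l') : ColPart (k + k') (l + l') where
  upper := Fin.append p.upper q.upper
  lower := Fin.append p.lower q.lower
  blocks := (sumSetoid p.blocks q.blocks).comap split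

/-- Vertical concatenation of `q` (above) and `p` (below): the blocks on the upper, middle and
lower points are those generated by the blocks of `q` and of `p`; then the middle points are
removed. This is the composition `p q`, which is formed only when `q.lower = p.upper`. -/
def comp (p : ColPart l m) (q : ColPart k l) : ColPart k m where
  upper := q.upper
  lower := p.lower
  blocks :=
    (q.blocks.map (Sum.map id Sum.inl : Fin k ⊕ Fin l → Fin k ⊕ (Fin l ⊕ Fin m)) ⊔
      p.blocks.map (Sum.inr : Fin l ⊕ Fin m → Fin k ⊕ (Fin l ⊕ Fin m))).comap
      (Sum.map id Sum.inr : Fin k ⊕ Fin m → Fin k ⊕ (Fin l ⊕ Fin m))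

/-- The involution `p*`: reflection at the horizontal axis. -/
def invol (p : ColPart k l) : ColPart l k where
  upper := p.lower
  lower := p.upper
  blocks := p.blocks.comap Sum.swap

/-- The identity partition on one point of color `c`. -/
def ident (c : Color) : ColPart 1 1 where
  upper := fun _ => c
  lower := fun _ => c
  blocks := ⊤

/-- The partition without upper points given by a word: two points belong to the same block iff
they carry the same letter. -/
def ofWord (color : Fin l → Color) (letter : Fin l → ℕ) : ColPart 0 l where
  upper := Fin.elim0
  lower := color
  blocks := Setoid.ker (Sum.elim Fin.elim0 letter)

/-- The empty partition. -/
def empty : ColPart 0 0 := ofWord Fin.elim0 Fin.elim0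

/-- The partition without upper points that has a single block. -/
def oneBlock (color : Fin l → Color) : ColPart 0 l := ofWord color (fun _ => 0)

/-- The pair partition on two lower points of colors `c` and `d`. -/
def pair (c d : Color) : ColPart 0 2 := oneBlock ![c, d]

/-- The singleton partition on one lower point. -/
def single (c : Color) : ColPart 0 1 := oneBlock ![c]

/-- The four block partition on four lower points of colors white, black, white, black. -/
def fourWBWB : ColPart 0 4 := oneBlock ![white, black, white, black]

/-- The partition `a b c b⁻¹` on four lower points of colors white, white, black, black: the second
and the fourth point form a block, the two others are singletons. -/
def positionerWWBB : ColPart 0 4 := ofWord ![white, white, black, black] ![0, 1, 2, 1]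

/-- The partition `b_s` consisting of a single block of `s` white lower points. -/
def b (s : ℕ) : ColPart 0 s := oneBlock (fun _ => white)

/-- The tensor power `p^{⊗ n}` of a partition without upper points; `p^{⊗ 0}` is empty. -/
def tpow (p : ColPart 0 l) : (n : ℕ) → ColPart 0 (l * n)
  | 0 => empty
  | n + 1 => (tpow p n).tensor p

/-- `pair white white ⊗ pair black black`. -/
def pairWWtensorBB : ColPart 0 4 := (pair white white).tensor (pair black black)

/-- `single white ⊗ single black`. -/
def singleWtensorB : ColPart 0 2 := (single white).tensor (single black)

end ColPart

open ColPart

/-- A collection of subsets of the sets of partitions with `k` upper and `l` lower points. -/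
abbrev Collection : Type := (k l : ℕ) → Set (ColPart k l)

/-- Categories of partitions. -/
structure IsCategory (C : Collection) : Prop where
  tensor_mem : ∀ {k l k' l' : ℕ} (p : ColPart k l) (q : ColPart k' l'),
    p ∈ C k l → q ∈ C k' l' → p.tensor q ∈ C (k + k') (l + l')
  comp_mem : ∀ {k l m : ℕ} (q : ColPart k l) (p : ColPart l m),
    q ∈ C k l → p ∈ C l m → q.lower = p.upper → p.comp q ∈ C k m
  invol_mem : ∀ {k l : ℕ} (p : ColPart k l), p ∈ C k l → p.invol ∈ C l k
  pairWB_mem : pair white black ∈ C 0 2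
  pairBW_mem : pair black white ∈ C 0 2
  identW_mem : ident white ∈ C 1 1
  identB_mem : ident black ∈ C 1 1

/-- The collection consists of noncrossing partitions. -/
def Noncrossing (C : Collection) : Prop :=
  ∀ (k l : ℕ) (p : ColPart k l), p ∈ C k l → p.IsNoncrossing

/-- A partition together with its numbers of upper and lower points. -/
abbrev AnyColPart : Type := Σ k l : ℕ, ColPart k l

/-- A partition as an element of `AnyColPart`. -/
def toAny {k l : ℕ} (p : ColPart k l) : AnyColPart := ⟨k, l, p⟩

/-- The smallest category of partitions that contains the partitions in `G`. -/
def generated (G : Set AnyColPart) : Collection := fun k l =>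
  {p | ∀ D : Collection, IsCategory D → (∀ g ∈ G, g.2.2 ∈ D g.1 g.2.1) → p ∈ D k l}

theorem isCategory_generated (G : Set AnyColPart) : IsCategory (generated G) where
  tensor_mem p q hp hq D hD hG := hD.tensor_mem p q (hp D hD hG) (hq D hD hG)
  comp_mem q p hq hp h D hD hG := hD.comp_mem q p (hq D hD hG) (hp D hD hG) h
  invol_mem p hp D hD hG := hD.invol_mem p (hp D hD hG)
  pairWB_mem _ hD _ := hD.pairWB_mem
  pairBW_mem _ hD _ := hD.pairBW_mem
  identW_mem _ hD _ := hD.identW_mem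
  identB_mem _ hD _ := hD.identB_mem

theorem mem_generated (G : Set AnyColPart) (g : AnyColPart) (hg : g ∈ G) :
    g.2.2 ∈ generated G g.1 g.2.1 :=
  fun _ _ hG => hG g hg

theorem generated_least (G : Set AnyColPart) (D : Collection) (hD : IsCategory D)
    (hG : ∀ g ∈ G, g.2.2 ∈ D g.1 g.2.1) (k l : ℕ) : generated G k l ⊆ D k l :=
  fun _ hp => hp D hD hG

/-- Globally colorized collections. -/
def GloballyColorized (C : Collection) : Prop := pairWWtensorBB ∈ C 0 4

/-- Case `O`. -/
def CaseO (C : Collection) : Prop := singleWtensorB ∉ C 0 2 ∧ fourWBWB ∉ C 0 4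

/-- Case `B`. -/
def CaseB (C : Collection) : Prop := singleWtensorB ∈ C 0 2 ∧ fourWBWB ∉ C 0 4

/-- Case `H`. -/
def CaseH (C : Collection) : Prop := singleWtensorB ∉ C 0 2 ∧ fourWBWB ∈ C 0 4

/-- Case `S`. -/
def CaseS (C : Collection) : Prop := singleWtensorB ∈ C 0 2 ∧ fourWBWB ∈ C 0 4

/-- `O_glob(k)`, used for even `k` only. -/
def oGlob (k : ℕ) : Collection :=
  generated {toAny ((pair white white).tpow (k / 2)), toAny pairWWtensorBB}

/-- `H_glob(k)`, used for even `k` only. -/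
def hGlob (k : ℕ) : Collection :=
  generated {toAny (b k), toAny fourWBWB, toAny pairWWtensorBB}

/-- `S_glob(k)`. -/
def sGlob (k : ℕ) : Collection :=
  generated {toAny ((single white).tpow k), toAny fourWBWB, toAny singleWtensorB, toAny pairWWtensorBB}

/-- `B_glob(k)`, used for even `k` only. -/
def bGlob (k : ℕ) : Collection :=
  generated {toAny ((single white).tpow k), toAny singleWtensorB, toAny pairWWtensorBB}

/-- `B'_glob(k)`. -/
def bPrimeGlob (k : ℕ) : Collection :=
  generated {toAny ((single white).tpow k), toAny positionerWWBB, toAny singleWtensorB,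
    toAny pairWWtensorBB}

end TwoColored

open TwoColored

/-!
A category of partitions is determined by its partitions without upper points, because upper points
can be rotated to the lower line (`IsCategory.mem_iff_word`). Such a partition is handled as a word:
a list of colored letters, where equal letters mark the points of a block. On words, a category is
closed under concatenation, rotation, reflection, and joining two adjacent points of opposite
colors, which identifies their letters.

In a globally colorized category, adjacent points may exchange their colors
(`IsGlobCategory.word_swap`), so membership of a word depends only on its letters and on its degree,
the number of white minus the number of black points. The degrees of the words of `C` form a
subgroup `kℤ` of the integers, and this `k` is the parameter of the theorem. A word of degree `d`
can be exchanged for any other word of degree `d` by composing with a word of degree zero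
(`IsGlobCategory.mem_of_bal_reverse`). Hence `C` is determined by `k` together with the uncolored
words that it contains in balanced coloring, `Bal C`, and it remains to see that these words can
already be built from the generators other than the one that carries `k`; see
`eq_generated_insert`.

A word with a singleton yields two singletons, and a noncrossing word with a block of size at least
three yields the block of size four (`IsGlobCategory.bal_two_of_singleton`,
`IsGlobCategory.bal_four_of_three_sublist`). Both follow from composing a partition with its own
involution. This restricts the block sizes in each case, and the words are then built by induction
on their length.

* Without singletons, every nonempty noncrossing word has an interval block. Two of its points can
  be joined and removed in `C`, and inserted again by means of a pair or of the block of size four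
  (`Part.bal_of_no_singleton`). No word has odd length, as it could be reduced to a singleton.
* With the positioner, singletons move freely, and every noncrossing word with admissible block
  sizes can be built, up to one additional singleton if its length is odd
  (`IsGlobCategory.bal_of_nc`). In case `S` the positioner arises by cutting points off the block of size four.
* With singletons, but without the positioner and the block of size four, a singleton directly
  enclosed by a pair is impossible. So every nonempty word of even length contains two adjacent
  singletons or an adjacent pair, which can be removed (`Part.bal_of_no_positioner`). Again no word
  has odd length, since nesting it in a pair would give the positioner.
-/

open TwoColored

namespace TwoColored
open Color ColPart

/-! ### Partitions as labelled lists -/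

/-- The opposite color. -/
def Color.bar : Color → Color
  | white => black
  | black => white

@[simp] theorem Color.bar_bar (c : Color) : c.bar.bar = c := by cases c <;> rfl

/-- The partition whose blocks are the fibers of a labelling of the points. -/
def ofFns {k l : ℕ} {α : Type} (cu : Fin k → Color) (cl : Fin l → Color) (f : Fin k → α)
    (g : Fin l → α) : ColPart k l :=
  ⟨cu, cl, Setoid.ker (Sum.elim f g)⟩

theorem ofFns_blocks {k l : ℕ} {α : Type} (cu : Fin k → Color) (cl : Fin l → Color)
    (f : Fin k → α) (g : Fin l → α) (x y : Fin k ⊕ Fin l) :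
    (ofFns cu cl f g).blocks x y ↔ Sum.elim f g x = Sum.elim f g y := Iff.rfl

/-- The partition given by two lists of colored letters, one for each line: the blocks consist of
the points that carry the same letter. -/
def ofLists {α : Type} (u v : List (Color × α)) : ColPart u.length v.length :=
  ofFns (fun i => (u.get i).1) (fun j => (v.get j).1) (fun i => (u.get i).2) (fun j => (v.get j).2)

/-- Membership in a collection of the partition given by two lists of colored letters. Lists have
no dependent lengths, so that equal lists can be rewritten freely. -/
def Mem {α : Type} (C : Collection) (u v : List (Color × α)) : Prop :=
  ofLists u v ∈ C u.length v.length

theorem toAny_ofLists_eq {α : Type} {k l : ℕ} {cu : Fin k → Color} {cl : Fin l → Color}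
    {f : Fin k → α} {g : Fin l → α} {u v : List (Color × α)}
    (hu : u = List.ofFn fun i => (cu i, f i)) (hv : v = List.ofFn fun j => (cl j, g j)) :
    toAny (ofLists u v) = toAny (ofFns cu cl f g) := by
  obtain rfl : k = u.length := by simp [hu]
  obtain rfl : l = v.length := by simp [hv]
  have h1 : u.get = fun i => (cu i, f i) :=
    List.ofFn_injective ((List.ofFn_get u).trans hu)
  have h2 : v.get = fun i => (cl i, g i) :=
    List.ofFn_injective ((List.ofFn_get v).trans hv)
  rw [ofLists, h1, h2]

theorem mem_of_toAny_eq {C : Collection} {k l k' l' : ℕ} {p : ColPart k l} {q : ColPart k' l'}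
    (h : toAny p = toAny q) : p ∈ C k l ↔ q ∈ C k' l' := by
  simp only [toAny] at h
  obtain ⟨rfl, h⟩ := Sigma.mk.inj_iff.1 h
  obtain ⟨rfl, h⟩ := Sigma.mk.inj_iff.1 (eq_of_heq h)
  rw [eq_of_heq h]

theorem mem_ofFns_iff {α : Type} (C : Collection) {k l : ℕ} (cu : Fin k → Color)
    (cl : Fin l → Color) (f : Fin k → α) (g : Fin l → α) :
    Mem C (List.ofFn fun i => (cu i, f i)) (List.ofFn fun j => (cl j, g j)) ↔
      ofFns cu cl f g ∈ C k l :=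
  mem_of_toAny_eq (toAny_ofLists_eq rfl rfl)

/-- Every partition is given by labelled lists: label each point by its block. -/
theorem exists_eq_ofFns {k l : ℕ} (p : ColPart k l) :
    p = ofFns p.upper p.lower (fun i => Quotient.mk p.blocks (Sum.inl i))
      (fun j => Quotient.mk p.blocks (Sum.inr j)) := by
  have : (Sum.elim (fun i => Quotient.mk p.blocks (Sum.inl i))
      (fun j => Quotient.mk p.blocks (Sum.inr j)) : Fin k ⊕ Fin l → _) = Quotient.mk p.blocks := by
    funext x; cases x <;> rfl
  ext
  · rfl
  · rfl
  · rw [ofFns_blocks, this]; exact Quotient.eq.symm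

/-- Only the kernel of the labelling matters. -/
theorem mem_map {α β : Type} {C : Collection} {u v : List (Color × α)} (F : α → β)
    (hF : ∀ a ∈ (u ++ v).map Prod.snd, ∀ b ∈ (u ++ v).map Prod.snd, F a = F b → a = b) :
    Mem C (u.map (Prod.map id F)) (v.map (Prod.map id F)) ↔ Mem C u v := by
  refine mem_of_toAny_eq ((toAny_ofLists_eq
    (cu := fun i => (u.get i).1) (cl := fun j => (v.get j).1)
    (f := fun i => F (u.get i).2) (g := fun j => F (v.get j).2) ?_ ?_).trans ?_)
  · conv_lhs => rw [← List.ofFn_get u, List.map_ofFn]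
    rfl
  · conv_lhs => rw [← List.ofFn_get v, List.map_ofFn]
    rfl
  · congr 1
    ext x y
    · rfl
    · rfl
    · rw [ofLists, ofFns_blocks, ofFns_blocks]
      have key : ∀ x : Fin u.length ⊕ Fin v.length,
          Sum.elim (fun i => (u.get i).2) (fun j => (v.get j).2) x ∈ (u ++ v).map Prod.snd := by
        rintro (i | i)
        · exact List.mem_map_of_mem (List.mem_append_left _ (List.get_mem u i))
        · exact List.mem_map_of_mem (List.mem_append_right _ (List.get_mem v i))
      have e : (Sum.elim (fun i => F (u.get i).2) (fun j => F (v.get j).2) :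
          Fin u.length ⊕ Fin v.length → β) =
          F ∘ Sum.elim (fun i => (u.get i).2) (fun j => (v.get j).2) := by
        funext x; cases x <;> rfl
      rw [e]
      exact ⟨fun h => hF _ (key x) _ (key y) h, fun h => congrArg F h⟩

theorem ofFns_tensor {α β : Type} {k l k' l' : ℕ} (cu : Fin k → Color)
    (cl : Fin l → Color) (f : Fin k → α) (g : Fin l → α) (cu' : Fin k' → Color)
    (cl' : Fin l' → Color) (f' : Fin k' → β) (g' : Fin l' → β) :
    (ofFns cu cl f g).tensor (ofFns cu' cl' f' g') =
      ofFns (Fin.append cu cu') (Fin.append cl cl')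
        (Fin.append (fun i => (Sum.inl (f i) : α ⊕ β)) (fun i => Sum.inr (f' i)))
        (Fin.append (fun i => (Sum.inl (g i) : α ⊕ β)) (fun i => Sum.inr (g' i))) := by
  ext x y
  · rfl
  · rfl
  · rw [ofFns_blocks]
    change Sum.LiftRel (fun a b => Sum.elim f g a = Sum.elim f g b)
      (fun a b => Sum.elim f' g' a = Sum.elim f' g' b) (split x) (split y) ↔ _
    have key : ∀ x : Fin (k + k') ⊕ Fin (l + l'),
        Sum.elim (Fin.append (fun i => (Sum.inl (f i) : α ⊕ β)) (fun i => Sum.inr (f' i)))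
          (Fin.append (fun i => (Sum.inl (g i) : α ⊕ β)) (fun i => Sum.inr (g' i))) x =
        Sum.map (Sum.elim f g) (Sum.elim f' g') (split x) := by
      rintro (i | i) <;> refine Fin.addCases (fun i => ?_) (fun i => ?_) i <;> simp [split]
    rw [key, key]
    generalize split x = a
    generalize split y = b
    constructor
    · rintro (h | h)
      · exact congrArg Sum.inl h
      · exact congrArg Sum.inr h
    · intro h
      rcases a with a | a <;> rcases b with b | b <;> simp only [Sum.map_inl, Sum.map_inr,
        Sum.inl.injEq, Sum.inr.injEq, reduceCtorEq] at h
      · exact Sum.LiftRel.inl h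
      · exact Sum.LiftRel.inr h

theorem ofLists_eq {α : Type} (u v : List (Color × α)) : ofLists u v =
  ofFns (fun i => (u.get i).1) (fun j => (v.get j).1) (fun i => (u.get i).2)
    (fun j => (v.get j).2) := rfl

theorem toAny_tensor {α β : Type} (u v : List (Color × α)) (u' v' : List (Color × β)) :
    toAny (ofLists (u.map (Prod.map id (Sum.inl : α → α ⊕ β)) ++ u'.map (Prod.map id Sum.inr))
      (v.map (Prod.map id Sum.inl) ++ v'.map (Prod.map id Sum.inr))) =
      toAny ((ofLists u v).tensor (ofLists u' v')) := by
  rw [ofLists_eq u v, ofLists_eq u' v', ofFns_tensor]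
  have key : ∀ (u : List (Color × α)) (u' : List (Color × β)),
      u.map (Prod.map id (Sum.inl : α → α ⊕ β)) ++ u'.map (Prod.map id Sum.inr) =
      List.ofFn fun i => (Fin.append (fun i => (u.get i).1) (fun i => (u'.get i).1) i,
        Fin.append (fun i => (Sum.inl (u.get i).2 : α ⊕ β)) (fun i => Sum.inr (u'.get i).2) i) := by
    intro u u'
    have e : (fun i => (Fin.append (fun i => (u.get i).1) (fun i => (u'.get i).1) i,
        Fin.append (fun i => (Sum.inl (u.get i).2 : α ⊕ β)) (fun i => Sum.inr (u'.get i).2) i)) =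
        Fin.append (fun i => Prod.map id (Sum.inl : α → α ⊕ β) (u.get i))
          (fun i => Prod.map id Sum.inr (u'.get i)) := by
      funext i
      refine Fin.addCases (fun i => ?_) (fun i => ?_) i <;> simp <;> rfl
    rw [e, List.ofFn_fin_append]
    congr 1
    · conv_lhs => rw [← List.ofFn_get u, List.map_ofFn]
      rfl
    · conv_lhs => rw [← List.ofFn_get u', List.map_ofFn]
      rfl
  exact toAny_ofLists_eq (key _ _) (key _ _)

/-- Composition of labelled partitions. If `F` and `G` identify the letters of the upper and of the
lower partition consistently along the middle line, and if identified letters of outer points are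
connected through the middle line (which is witnessed by linking each of them to an anchor `A c`
that depends only on the common value `c`), then the composition is labelled by `F` and `G`. -/
theorem ofFns_comp {α β γ : Type} {k l m : ℕ} (cu : Fin k → Color) (cv : Fin l → Color)
    (cw : Fin m → Color) (f : Fin k → α) (g : Fin l → α) (g' : Fin l → β) (h : Fin m → β)
    (F : α → γ) (G : β → γ) (hFG : ∀ j, F (g j) = G (g' j)) (A : γ → α ⊕ β)
    (hf : ∀ i, Relation.EqvGen (fun s t => ∃ j, s = Sum.inl (g j) ∧ t = Sum.inr (g' j))
      (Sum.inl (f i)) (A (F (f i))))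
    (hh : ∀ i, Relation.EqvGen (fun s t => ∃ j, s = Sum.inl (g j) ∧ t = Sum.inr (g' j))
      (Sum.inr (h i)) (A (G (h i)))) :
    (ofFns cv cw g' h).comp (ofFns cu cv f g) = ofFns cu cw (F ∘ f) (G ∘ h) := by
  ext x y
  · rfl
  · rfl
  rw [ofFns_blocks]
  simp only [Setoid.comap_rel]
  set φ : Fin k ⊕ Fin l → Fin k ⊕ (Fin l ⊕ Fin m) := Sum.map id Sum.inl
  set ψ : Fin l ⊕ Fin m → Fin k ⊕ (Fin l ⊕ Fin m) := Sum.inr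
  set J := (ofFns cu cv f g).blocks.map φ ⊔ (ofFns cv cw g' h).blocks.map ψ with hJ
  constructor
  · -- the final labelling is constant on the blocks of both partitions
    have hle : J ≤ Setoid.ker (Sum.elim (F ∘ f) (Sum.elim (F ∘ g) (G ∘ h))) := by
      refine sup_le (Setoid.eqvGen_le ?_) (Setoid.eqvGen_le ?_)
      · rintro _ _ ⟨a, b, hab, rfl, rfl⟩
        have hab : Sum.elim f g a = Sum.elim f g b := hab
        have e : ∀ a : Fin k ⊕ Fin l, Sum.elim (F ∘ f) (Sum.elim (F ∘ g) (G ∘ h)) (φ a) =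
            F (Sum.elim f g a) := by rintro (a | a) <;> rfl
        exact (e a).trans ((congrArg F hab).trans (e b).symm)
      · rintro _ _ ⟨a, b, hab, rfl, rfl⟩
        have hab : Sum.elim g' h a = Sum.elim g' h b := hab
        have e : ∀ a : Fin l ⊕ Fin m, Sum.elim (F ∘ f) (Sum.elim (F ∘ g) (G ∘ h)) (ψ a) =
            G (Sum.elim g' h a) := by
          rintro (a | a)
          · exact hFG a
          · rfl
        exact (e a).trans ((congrArg G hab).trans (e b).symm)
    intro hxy
    have := hle hxy
    rcases x with x | x <;> rcases y with y | y <;> exact this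
  · intro hxy
    -- `lab x s` says that the point `x` carries the letter `s`; the relation `S` on letters says
    -- that points carrying them are connected
    let lab : Fin k ⊕ (Fin l ⊕ Fin m) → α ⊕ β → Prop := fun x s =>
      (∃ z, x = φ z ∧ s = Sum.inl (Sum.elim f g z)) ∨
        (∃ z, x = ψ z ∧ s = Sum.inr (Sum.elim g' h z))
    have hlab : ∀ x y s, lab x s → lab y s → J x y := by
      rintro x y s (⟨z, rfl, rfl⟩ | ⟨z, rfl, rfl⟩) (⟨z', rfl, h'⟩ | ⟨z', rfl, h'⟩)
      · exact (le_sup_left : _ ≤ J)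
          (Relation.EqvGen.rel _ _ ⟨z, z', Sum.inl_injective h', rfl, rfl⟩)
      · cases h'
      · cases h'
      · exact (le_sup_right : _ ≤ J)
          (Relation.EqvGen.rel _ _ ⟨z, z', Sum.inr_injective h', rfl, rfl⟩)
    let S : Setoid (α ⊕ β) :=
      { r := fun s t => s = t ∨ ∃ x y, lab x s ∧ lab y t ∧ J x y
        iseqv :=
          { refl := fun s => Or.inl rfl
            symm := by
              rintro s t (rfl | ⟨x, y, hx, hy, hxy⟩)
              · exact Or.inl rfl
              · exact Or.inr ⟨y, x, hy, hx, J.symm hxy⟩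
            trans := by
              rintro s t r (rfl | ⟨x, y, hx, hy, hxy⟩) (rfl | ⟨x', y', hx', hy', hxy'⟩)
              · exact Or.inl rfl
              · exact Or.inr ⟨x', y', hx', hy', hxy'⟩
              · exact Or.inr ⟨x, y, hx, hy, hxy⟩
              · exact Or.inr ⟨x, y', hx, hy', J.trans hxy (J.trans (hlab _ _ _ hy hx') hxy')⟩ } }
    have hS : ∀ s t, Relation.EqvGen (fun s t => ∃ j, s = Sum.inl (g j) ∧ t = Sum.inr (g' j)) s t →
        S s t := by
      have : Relation.EqvGen.setoid
          (fun s t => ∃ j, s = Sum.inl (g j) ∧ t = Sum.inr (g' j)) ≤ S := by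
        refine Setoid.eqvGen_le ?_
        rintro s t ⟨j, rfl, rfl⟩
        exact Or.inr ⟨φ (Sum.inr j), ψ (Sum.inl j), Or.inl ⟨_, rfl, rfl⟩, Or.inr ⟨_, rfl, rfl⟩,
          J.refl _⟩
      exact fun s t h => this h
    have key : ∀ x : Fin k ⊕ Fin m, ∃ s, lab (Sum.map id Sum.inr x) s ∧
        S s (A (Sum.elim (F ∘ f) (G ∘ h) x)) := by
      rintro (i | i)
      · exact ⟨_, Or.inl ⟨Sum.inl i, rfl, rfl⟩, hS _ _ (hf i)⟩
      · exact ⟨_, Or.inr ⟨Sum.inr i, rfl, rfl⟩, hS _ _ (hh i)⟩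
    obtain ⟨s, hs, hs'⟩ := key x
    obtain ⟨t, ht, ht'⟩ := key y
    rw [hxy] at hs'
    rcases S.trans hs' (S.symm ht') with rfl | ⟨x', y', hx, hy, hxy⟩
    · exact hlab _ _ _ hs ht
    · exact J.trans (hlab _ _ _ hs hx) (J.trans hxy (hlab _ _ _ hy ht))

/-! ### Operations on words of a category -/

/-- Apply a map to the letters of a list of colored letters. -/
def mapLetters {α β : Type} (F : α → β) (W : List (Color × α)) : List (Color × β) :=
  W.map (Prod.map id F)

/-- The letters of a list of colored letters. -/
def letters {α : Type} (W : List (Color × α)) : List α := W.map Prod.snd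

section
variable {α β γ : Type}

@[simp] theorem mapLetters_nil (F : α → β) : mapLetters F [] = [] := rfl
@[simp] theorem mapLetters_cons (F : α → β) (c : Color) (a : α) (W : List (Color × α)) :
    mapLetters F ((c, a) :: W) = (c, F a) :: mapLetters F W := rfl
@[simp] theorem mapLetters_append (F : α → β) (V W : List (Color × α)) :
    mapLetters F (V ++ W) = mapLetters F V ++ mapLetters F W := List.map_append
@[simp] theorem mapLetters_mapLetters (G : β → γ) (F : α → β) (W : List (Color × α)) :
    mapLetters G (mapLetters F W) = mapLetters (G ∘ F) W := by
  simp [mapLetters]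
@[simp] theorem letters_nil : letters ([] : List (Color × α)) = [] := rfl
@[simp] theorem letters_cons (x : Color × α) (W : List (Color × α)) :
    letters (x :: W) = x.2 :: letters W := rfl
@[simp] theorem letters_append (V W : List (Color × α)) :
    letters (V ++ W) = letters V ++ letters W := List.map_append
@[simp] theorem letters_mapLetters (F : α → β) (W : List (Color × α)) :
    letters (mapLetters F W) = (letters W).map F := by
  simp [mapLetters, letters]
@[simp] theorem length_letters (W : List (Color × α)) : (letters W).length = W.length := by
  simp [letters]

theorem mapLetters_eq_self {F : α → α} {W : List (Color × α)} (h : ∀ a ∈ letters W, F a = a) :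
    mapLetters F W = W := by
  unfold mapLetters
  conv_rhs => rw [← List.map_id W]
  refine List.map_congr_left fun x hx => ?_
  exact Prod.ext rfl (h x.2 (List.mem_map_of_mem hx))

theorem mapLetters_congr {F G : α → β} {W : List (Color × α)} (h : ∀ a ∈ letters W, F a = G a) :
    mapLetters F W = mapLetters G W :=
  List.map_congr_left fun x hx => Prod.ext rfl (h x.2 (List.mem_map_of_mem hx))

/-- Two letters of vertically adjacent labelled partitions are linked if they are connected by a
chain of positions on the middle line. -/
def Link (v : List (Color × α)) (v' : List (Color × β)) : α ⊕ β → α ⊕ β → Prop :=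
  Relation.EqvGen fun s t =>
    ∃ p ∈ (letters v).zip (letters v'), s = Sum.inl p.1 ∧ t = Sum.inr p.2

theorem Link.refl {v : List (Color × α)} {v' : List (Color × β)} (s : α ⊕ β) : Link v v' s s :=
  Relation.EqvGen.refl s

theorem Link.symm {v : List (Color × α)} {v' : List (Color × β)} {s t : α ⊕ β}
    (h : Link v v' s t) : Link v v' t s :=
  Relation.EqvGen.symm _ _ h

theorem Link.trans {v : List (Color × α)} {v' : List (Color × β)} {s t r : α ⊕ β}
    (h : Link v v' s t) (h' : Link v v' t r) : Link v v' s r :=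
  Relation.EqvGen.trans _ _ _ h h'

theorem Link.of_mem {v : List (Color × α)} {v' : List (Color × β)} {a : α} {b : β}
    (h : (a, b) ∈ (letters v).zip (letters v')) : Link v v' (Sum.inl a) (Sum.inr b) :=
  Relation.EqvGen.rel _ _ ⟨_, h, rfl, rfl⟩

variable {C : Collection}

theorem mem_mapLetters {u v : List (Color × α)} (F : α → β)
    (hF : ∀ a ∈ letters u ++ letters v, ∀ b ∈ letters u ++ letters v, F a = F b → a = b) :
    Mem C (mapLetters F u) (mapLetters F v) ↔ Mem C u v :=
  mem_map F (by simpa only [letters, List.map_append] using hF)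

/-- Composition in terms of labelled lists, see `ofFns_comp`. -/
theorem IsCategory.mem_comp (hC : IsCategory C) {u v : List (Color × α)}
    {v' w : List (Color × β)} (F : α → γ) (G : β → γ) (hvv : mapLetters F v = mapLetters G v')
    (A : γ → α ⊕ β) (hu : ∀ a ∈ letters u, Link v v' (Sum.inl a) (A (F a)))
    (hw : ∀ b ∈ letters w, Link v v' (Sum.inr b) (A (G b)))
    (h1 : Mem C u v) (h2 : Mem C v' w) : Mem C (mapLetters F u) (mapLetters G w) := by
  have hlen : v.length = v'.length := by simpa [mapLetters] using congrArg List.length hvv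
  have hpos : ∀ (j : ℕ) (h : j < v.length), (v[j].1 = (v'[j]'(hlen ▸ h)).1) ∧
      F v[j].2 = G (v'[j]'(hlen ▸ h)).2 := by
    intro j h
    have : (mapLetters F v)[j]'(by simpa [mapLetters] using h) =
        (mapLetters G v')[j]'(by simpa [mapLetters, hlen] using h) := by simp only [hvv]
    simpa [mapLetters, Prod.ext_iff] using this
  have h2' : ofFns (fun j : Fin v.length => (v.get j).1) (fun i => (w.get i).1)
      (fun j : Fin v.length => (v'.get (Fin.cast hlen j)).2) (fun i => (w.get i).2) ∈
        C v.length w.length := by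
    refine (mem_of_toAny_eq (toAny_ofLists_eq ?_ ?_)).1 h2
    · refine List.ext_getElem (by simp [hlen]) fun j hj hj' => ?_
      have := hpos j (by simpa using hj')
      simp [this.1]
    · exact (List.ofFn_get w).symm
  have hC' := hC.comp_mem _ _ h1 h2' rfl
  have hlink : ∀ s t, Link v v' s t → Relation.EqvGen (fun s t => ∃ j : Fin v.length,
      s = Sum.inl (v.get j).2 ∧ t = Sum.inr (v'.get (Fin.cast hlen j)).2) s t := by
    intro s t h
    refine Relation.EqvGen.mono ?_ _ _ h
    rintro _ _ ⟨p, hp, rfl, rfl⟩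
    obtain ⟨j, hj, rfl⟩ := List.getElem_of_mem hp
    exact ⟨⟨j, by simp at hj; omega⟩, by simp [letters], by simp [letters]⟩
  simp only [ofLists] at hC'
  rw [ofFns_comp (F := F) (G := G) (g := fun j => (v.get j).2)
    (g' := fun j => (v'.get (Fin.cast hlen j)).2) (hFG := fun j => (hpos j j.2).2) (A := A)] at hC'
  · refine (mem_of_toAny_eq (toAny_ofLists_eq ?_ ?_)).2 hC'
    · conv_lhs => rw [mapLetters, ← List.ofFn_get u, List.map_ofFn]
      rfl
    · conv_lhs => rw [mapLetters, ← List.ofFn_get w, List.map_ofFn]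
      rfl
  · exact fun i => hlink _ _ (hu _ (List.mem_map_of_mem (List.get_mem u i)))
  · exact fun i => hlink _ _ (hw _ (List.mem_map_of_mem (List.get_mem w i)))

theorem IsCategory.mem_invol (hC : IsCategory C) {u v : List (Color × α)} (h : Mem C u v) :
    Mem C v u := by
  have : (ofLists u v).invol = ofLists v u := by
    ext x y
    · rfl
    · rfl
    · change Sum.elim _ _ x.swap = Sum.elim _ _ y.swap ↔ _
      rw [ofLists, ofFns_blocks]
      rcases x with x | x <;> rcases y with y | y <;> rfl
  have h' := hC.invol_mem _ h
  rwa [this] at h'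

theorem IsCategory.mem_sum (hC : IsCategory C) {u v : List (Color × α)}
    {u' v' : List (Color × β)}
    (h : Mem C u v) (h' : Mem C u' v') :
    Mem C (mapLetters (Sum.inl : α → α ⊕ β) u ++ mapLetters Sum.inr u')
      (mapLetters Sum.inl v ++ mapLetters Sum.inr v') :=
  (mem_of_toAny_eq (toAny_tensor u v u' v')).2 (hC.tensor_mem _ _ h h')

theorem IsCategory.mem_append (hC : IsCategory C) {u v u' v' : List (Color × α)}
    (h : Mem C u v) (h' : Mem C u' v')
    (hd : ∀ a ∈ letters u ++ letters v, a ∉ letters u' ++ letters v') :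
    Mem C (u ++ u') (v ++ v') := by
  have := (mem_mapLetters (C := C) (Sum.elim id id : α ⊕ α → α) ?_).2 (hC.mem_sum h h')
  · have e1 : (Sum.elim id id : α ⊕ α → α) ∘ Sum.inl = id := rfl
    have e2 : (Sum.elim id id : α ⊕ α → α) ∘ Sum.inr = id := rfl
    have e3 : ∀ w : List (Color × α), mapLetters id w = w := fun w =>
      mapLetters_eq_self fun _ _ => rfl
    simpa [e1, e2, e3] using this
  · simp only [letters_append, letters_mapLetters, List.mem_append, List.mem_map] at hd ⊢
    rintro a ha b hb hab
    rcases a with a | a <;> rcases b with b | b <;>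
      simp at ha hb hab ⊢ <;> subst hab <;> first | trivial | (have := hd a; tauto)

theorem toAny_ofWord {l : ℕ} (color : Fin l → Color) (letter : Fin l → ℕ) :
    toAny (ofWord color letter) = toAny (ofLists [] (List.ofFn fun i => (color i, letter i))) :=
  (toAny_ofLists_eq rfl rfl).symm

theorem mem_ofWord (C : Collection) {l : ℕ} (color : Fin l → Color) (letter : Fin l → ℕ) :
    Mem C [] (List.ofFn fun i => (color i, letter i)) ↔ ofWord color letter ∈ C 0 l :=
  mem_of_toAny_eq (toAny_ofWord color letter).symm

theorem IsCategory.mem_pair (hC : IsCategory C) (c : Color) (a : α) :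
    Mem C [] [(c, a), (c.bar, a)] := by
  have key : ∀ c d : Color, pair c d ∈ C 0 2 → Mem C [] [(c, a), (d, a)] := by
    intro c d h
    have h0 : Mem C [] [(c, 0), (d, 0)] := by
      simpa using (mem_ofWord C ![c, d] fun _ => 0).2 h
    simpa using (mem_mapLetters (u := []) (fun _ : ℕ => a) (by simp)).2 h0
  cases c
  · exact key _ _ hC.pairWB_mem
  · exact key _ _ hC.pairBW_mem

theorem IsCategory.mem_ident (hC : IsCategory C) (c : Color) (a : α) :
    Mem C [(c, a)] [(c, a)] := by
  have h : ident c ∈ C 1 1 := by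
    cases c
    · exact hC.identW_mem
    · exact hC.identB_mem
  have e : ident c = ofLists [(c, a)] [(c, a)] := by
    ext x y
    · simp [ident, ofLists, ofFns]
    · simp [ident, ofLists, ofFns]
    · rw [ofLists, ofFns_blocks]
      refine ⟨fun _ => ?_, fun _ => trivial⟩
      rcases x with x | x <;> rcases y with y | y <;> simp
  rwa [e] at h

theorem IsCategory.mem_nil (hC : IsCategory C) : Mem C ([] : List (Color × α)) [] :=
  hC.mem_comp (α := Unit) (β := Unit) (γ := α ⊕ Unit) (u := []) (w := []) Sum.inr Sum.inr rfl
    (fun _ => Sum.inl ()) (by simp) (by simp) (hC.mem_pair white ())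
    (hC.mem_invol (hC.mem_pair white ())) |> fun h =>
      (mem_mapLetters (α := α) (β := α ⊕ Unit) (u := []) (v := []) Sum.inl (by simp)).1 h

/-- If the letters are pairwise different, then equal lines give a tensor product of identity
partitions. -/
theorem IsCategory.mem_id (hC : IsCategory C) {v : List (Color × α)} (hv : (letters v).Nodup) :
    Mem C v v := by
  induction v with
  | nil => exact hC.mem_nil
  | cons x v ih =>
    obtain ⟨c, a⟩ := x
    simp only [letters_cons, List.nodup_cons] at hv
    refine hC.mem_append (hC.mem_ident c a) (ih hv.2) ?_
    simp [hv.1]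

/-- Every list of colored letters arises from one with pairwise different letters. -/
theorem exists_nodup_mapLetters (v : List (Color × α)) :
    ∃ v' : List (Color × (α × ℕ)), mapLetters Prod.fst v' = v ∧ (letters v').Nodup := by
  refine ⟨v.zipIdx.map fun p => (p.1.1, (p.1.2, p.2)), ?_, ?_⟩
  · rw [mapLetters, List.map_map]
    conv_rhs => rw [← List.zipIdx_map_fst 0 v]
    rfl
  · have : ((letters (v.zipIdx.map fun p => (p.1.1, (p.1.2, p.2)))).map Prod.snd).Nodup := by
      rw [letters, List.map_map, List.map_map]
      have := List.zipIdx_map_snd 0 v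
      change (List.map Prod.snd v.zipIdx).Nodup
      rw [this]
      exact List.nodup_range'
    exact this.of_map

/-- Rotating the leftmost upper point to the lower line inverts its color. -/
theorem IsCategory.mem_rotate_down (hC : IsCategory C) {c : Color} {x : α}
    {u v : List (Color × α)} (h : Mem C ((c, x) :: u) v) : Mem C u ((c.bar, x) :: v) := by
  obtain ⟨u', hu', hnd⟩ := exists_nodup_mapLetters u
  -- the upper partition: a pair followed by identities
  have h1 : Mem C (mapLetters some u') ((c.bar, none) :: (c, none) :: mapLetters some u') := by
    have := hC.mem_append (hC.mem_pair c.bar (none : Option (α × ℕ)))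
      (hC.mem_id (v := mapLetters some u') ?_) (by simp)
    · simpa using this
    · rw [letters_mapLetters]; exact hnd.map (Option.some_injective _)
  -- the lower partition: an identity followed by the given partition
  have h2 : Mem C ((c.bar, none) :: (c, some x) :: mapLetters some u)
      ((c.bar, none) :: mapLetters some v) := by
    have := hC.mem_append (hC.mem_ident c.bar (none : Option α))
      ((mem_mapLetters some (by simp)).2 h) (by simp)
    simpa using this
  have := hC.mem_comp (γ := α) (fun o => o.elim x Prod.fst) (fun o => o.elim x id)
    (A := fun a => Sum.inr (some a)) ?_ ?_ ?_ h1 h2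
  · have e1 : (fun o : Option (α × ℕ) => o.elim x Prod.fst) ∘ some = Prod.fst := rfl
    have e2 : (fun o : Option α => o.elim x id) ∘ some = id := rfl
    simpa [e1, e2, hu', mapLetters_eq_self] using this
  · have e1 : (fun o : Option (α × ℕ) => o.elim x Prod.fst) ∘ some = Prod.fst := rfl
    have e2 : (fun o : Option α => o.elim x id) ∘ some = id := rfl
    simp [e1, e2, hu', mapLetters_eq_self]
  · intro a ha
    obtain ⟨b, hb, rfl⟩ : ∃ b ∈ letters u', some b = a := by simpa using ha
    refine Link.of_mem ?_
    simp only [letters_cons, letters_mapLetters, List.zip_cons_cons, List.mem_cons]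
    rw [← hu', letters_mapLetters, List.map_map]
    refine Or.inr (Or.inr ?_)
    rw [List.zip_map']
    exact List.mem_map.2 ⟨b, hb, rfl⟩
  · intro b hb
    rcases b with _ | b
    · refine (Link.of_mem (a := none) ?_).symm.trans (Link.of_mem (a := none) ?_) <;> simp
    · exact Link.refl _

theorem IsCategory.mem_rotate_up (hC : IsCategory C) {c : Color} {x : α}
    {u v : List (Color × α)} (h : Mem C u ((c, x) :: v)) : Mem C ((c.bar, x) :: u) v :=
  hC.mem_invol (hC.mem_rotate_down (hC.mem_invol h))

/-- A word read backwards with inverted colors. -/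
def tilde (W : List (Color × α)) : List (Color × α) := (W.map (Prod.map Color.bar id)).reverse

@[simp] theorem tilde_nil : tilde ([] : List (Color × α)) = [] := rfl
@[simp] theorem tilde_cons (c : Color) (a : α) (W : List (Color × α)) :
    tilde ((c, a) :: W) = tilde W ++ [(c.bar, a)] := by simp [tilde]
@[simp] theorem tilde_append (V W : List (Color × α)) :
    tilde (V ++ W) = tilde W ++ tilde V := by simp [tilde]
@[simp] theorem tilde_tilde (W : List (Color × α)) : tilde (tilde W) = W := by
  induction W with
  | nil => rfl
  | cons x W ih => obtain ⟨c, a⟩ := x; simp [ih]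
@[simp] theorem letters_tilde (W : List (Color × α)) :
    letters (tilde W) = (letters W).reverse := by
  simp [tilde, letters]
@[simp] theorem tilde_mapLetters (F : α → β) (W : List (Color × α)) :
    tilde (mapLetters F W) = mapLetters F (tilde W) := by
  simp [tilde, mapLetters]

/-- Rotating all upper points to the lower line: a category is determined by its partitions
without upper points. -/
theorem IsCategory.mem_iff_word (hC : IsCategory C) {u v : List (Color × α)} :
    Mem C u v ↔ Mem C [] (tilde u ++ v) := by
  induction u generalizing v with
  | nil => simp
  | cons x u ih =>
    obtain ⟨c, a⟩ := x
    have : Mem C ((c, a) :: u) v ↔ Mem C u ((c.bar, a) :: v) :=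
      ⟨hC.mem_rotate_down, fun h => by simpa using hC.mem_rotate_up h⟩
    rw [this, ih]
    simp

theorem IsCategory.word_tilde (hC : IsCategory C) {W : List (Color × α)} (h : Mem C [] W) :
    Mem C [] (tilde W) := by
  simpa using hC.mem_iff_word.1 (hC.mem_invol h)

/-- Joining two adjacent points of opposite colors identifies their letters. -/
theorem IsCategory.word_cap [DecidableEq α] (hC : IsCategory C) {c : Color} {a b : α}
    {W : List (Color × α)} (h : Mem C [] ((c, a) :: (c.bar, b) :: W)) :
    Mem C [] (mapLetters (fun z => if z = b then a else z) W) := by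
  obtain ⟨W', hW', hnd⟩ := exists_nodup_mapLetters W
  -- the lower partition: an upper pair followed by identities
  have h1 : Mem C ((c, none) :: (c.bar, none) :: mapLetters some W') (mapLetters some W') := by
    have := hC.mem_append (hC.mem_invol (hC.mem_pair c (none : Option (α × ℕ))))
      (hC.mem_id (v := mapLetters some W') ?_) (by simp)
    · simpa using this
    · rw [letters_mapLetters]; exact hnd.map (Option.some_injective _)
  set M : α → α := fun z => if z = b then a else z with hM
  have e2 : (fun o : Option (α × ℕ) => o.elim a (M ∘ Prod.fst)) ∘ some = M ∘ Prod.fst := rfl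
  have e3 : mapLetters (M ∘ Prod.fst) W' = mapLetters M W := by rw [← mapLetters_mapLetters, hW']
  have hMa : M a = a := by simp [hM]
  have hMb : M b = a := by simp [hM]
  have := hC.mem_comp (γ := α) M (fun o => o.elim a (M ∘ Prod.fst))
    (A := fun a => Sum.inl a) ?_ ?_ ?_ h h1
  · simpa [e2, e3] using this
  · simp [e2, e3, hMa, hMb]
  · simp
  · intro x hx
    obtain ⟨y, hy, rfl⟩ : ∃ b ∈ letters W', some b = x := by simpa using hx
    refine (Link.of_mem (a := y.1) ?_).symm.trans ?_
    · simp only [letters_cons, letters_mapLetters, List.zip_cons_cons, List.mem_cons]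
      rw [← hW', letters_mapLetters]
      refine Or.inr (Or.inr ?_)
      rw [List.zip_map']
      exact List.mem_map.2 ⟨y, hy, rfl⟩
    · by_cases hy : y.1 = b
      · simp only [Option.elim_some, Function.comp, hy, hMb]
        refine (Link.of_mem (b := none) ?_).trans (Link.of_mem (b := none) ?_).symm <;> simp
      · simp only [Option.elim_some, Function.comp, hM, if_neg hy]
        exact Link.refl _

/-- Putting a pair around a word. -/
theorem IsCategory.word_nest (hC : IsCategory C) (c : Color) {W : List (Color × α)}
    (h : Mem C [] W) : Mem C [] ((c, none) :: mapLetters some W ++ [(c.bar, none)]) := by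
  -- the lower partition: the word between two identities
  have h2 : Mem C [(c, none), (c.bar, some none)]
      ((c, none) :: mapLetters (some ∘ some) W ++ [(c.bar, some none)]) := by
    have := hC.mem_append (hC.mem_append (hC.mem_ident c (none : Option (Option α)))
      ((mem_mapLetters (some ∘ some) (by simp)).2 h) (by simp)) (hC.mem_ident c.bar (some none)) ?_
    · simpa using this
    · simp
  have := hC.mem_comp (γ := Option α) (fun _ => none) (fun o => o.elim none id)
    (A := fun a => a.elim (Sum.inl ()) (fun a => Sum.inr (some (some a)))) ?_ ?_ ?_
    (hC.mem_pair c ()) h2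
  · have e : (fun o : Option (Option α) => o.elim none id) ∘ some ∘ some = some := rfl
    simpa [e] using this
  · simp
  · simp
  · rintro (_ | _ | b) hb
    · exact (Link.of_mem (by simp)).symm
    · exact (Link.of_mem (by simp)).symm
    · exact Link.refl _

theorem IsCategory.word_rotate (hC : IsCategory C) {x : Color × α} {W : List (Color × α)}
    (h : Mem C [] (x :: W)) : Mem C [] (W ++ [x]) := by
  classical
  obtain ⟨c, a⟩ := x
  -- the left leg of a surrounding pair is joined to the first point, whose block is thereby
  -- continued by the right leg
  have h1 := hC.word_nest c.bar h
  have h2 := hC.word_cap (c := c.bar) (a := none) (b := some a) (by simpa using h1)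
  have h3 := (mem_mapLetters (C := C) (u := []) (v := W ++ [(c, a)])
    (fun z => if (some z : Option α) = some a then none else some z) ?_).1 ?_
  · exact h3
  · intro x _ y _ hxy
    by_cases hx : x = a <;> by_cases hy : y = a <;> simp_all
  · simpa [Function.comp_def] using h2

theorem IsCategory.word_rotate_append (hC : IsCategory C) {U V : List (Color × α)}
    (h : Mem C [] (U ++ V)) : Mem C [] (V ++ U) := by
  induction U generalizing V with
  | nil => simpa using h
  | cons x U ih =>
    have := ih (V := V ++ [x]) (by simpa using hC.word_rotate h)
    simpa using this

/-- Composing the partition with upper line `V` and lower line `X` with its own involution. The two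
copies of a letter of `X` stay connected if the letter also occurs in `V`, and are separated
otherwise. -/
theorem IsCategory.word_double [DecidableEq α] (hC : IsCategory C) {X V : List (Color × α)}
    (h : Mem C [] (X ++ V)) :
    Mem C [] (mapLetters Sum.inl (tilde X) ++
      mapLetters (fun a => if a ∈ letters V then (Sum.inl a : α ⊕ α) else Sum.inr a) X) := by
  have h1 : Mem C (tilde V) X := by
    rw [hC.mem_iff_word]; simpa using hC.word_rotate_append h
  have := hC.mem_comp (γ := α ⊕ α) (Sum.inl)
    (fun a => if a ∈ letters V then (Sum.inl a : α ⊕ α) else Sum.inr a)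
    (A := id) ?_ ?_ ?_ (hC.mem_invol h1) h1
  · rw [hC.mem_iff_word] at this
    simpa using this
  · refine mapLetters_congr fun a ha => ?_
    rw [if_pos (by simpa using ha)]
  · intro a _
    exact Link.refl _
  · intro b hb
    by_cases hb' : b ∈ letters V
    · simp only [if_pos hb', id]
      refine (Link.of_mem ?_).symm
      rw [letters_tilde, show ∀ l : List α, l.zip l = l.map fun a => (a, a) from
        fun l => by simpa using List.zip_map' (f := (id : α → α)) (g := id) (l := l)]
      simpa using hb'
    · simp only [if_neg hb', id]
      exact Link.refl _

/-- Removing a word of the category from a tensor product. -/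
theorem IsCategory.word_cancel (hC : IsCategory C) {W : List (Color × α)} {V : List (Color × β)}
    (h : Mem C [] W) (h' : Mem C [] (mapLetters Sum.inl (tilde W) ++ mapLetters Sum.inr V)) :
    Mem C [] V := by
  have h1 : Mem C (mapLetters (Sum.inl : α → α ⊕ β) W) (mapLetters Sum.inr V) := by
    rw [hC.mem_iff_word]; simpa using h'
  have := hC.mem_comp (γ := Option β) (fun _ => none) (Sum.elim (fun _ => none) some)
    (A := fun o => o.elim (Sum.inl none) fun b => Sum.inr (Sum.inr b))
    ?_ ?_ ?_ ((mem_mapLetters (u := []) some (by simp)).2 h) h1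
  · have e : (Sum.elim (fun _ => none) some : α ⊕ β → Option β) ∘ Sum.inr = some := rfl
    rw [mapLetters_mapLetters (F := Sum.inr), e] at this
    exact (mem_mapLetters (C := C) (u := []) some (by simp)).1 this
  · rw [mapLetters_mapLetters, mapLetters_mapLetters]
    rfl
  · simp
  · intro b hb
    obtain ⟨y, hy, rfl⟩ : ∃ y ∈ letters V, Sum.inr y = b := by simpa using hb
    exact Link.refl _
end

/-! ### Globally colorized categories and balanced words -/

section
variable {α β γ : Type} {C : Collection}

theorem word_mapLetters {W : List (Color × α)} (F : α → β)
    (hF : ∀ a ∈ letters W, ∀ b ∈ letters W, F a = F b → a = b) :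
    Mem C [] (mapLetters F W) ↔ Mem C [] W :=
  mem_mapLetters (u := []) F hF

/-- Joining two adjacent points of opposite colors in the middle of a word. -/
theorem IsCategory.word_cap_mid [DecidableEq α] (hC : IsCategory C) {c : Color} {a b : α}
    {U V : List (Color × α)} (h : Mem C [] (U ++ (c, a) :: (c.bar, b) :: V)) :
    Mem C [] (mapLetters (fun z => if z = b then a else z) (U ++ V)) := by
  have := hC.word_cap (by simpa using hC.word_rotate_append h)
  simpa using hC.word_rotate_append (by simpa using this)

/-- Globally colorized categories. -/
structure IsGlobCategory (C : Collection) : Prop extends IsCategory C where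
  glob : GloballyColorized C

theorem toAny_tensor_of_eq {k l k' l' : ℕ} {p : ColPart k l} {q : ColPart k' l'}
    {u v : List (Color × α)} {u' v' : List (Color × β)} (hp : toAny p = toAny (ofLists u v))
    (hq : toAny q = toAny (ofLists u' v')) : toAny (p.tensor q) =
      toAny (ofLists (mapLetters (Sum.inl : α → α ⊕ β) u ++ mapLetters Sum.inr u')
        (mapLetters Sum.inl v ++ mapLetters Sum.inr v')) := by
  refine Eq.trans ?_ (toAny_tensor u v u' v').symm
  generalize ofLists u v = r at hp
  generalize ofLists u' v' = r' at hq
  generalize u.length = n1, v.length = n2 at r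
  generalize u'.length = n1', v'.length = n2' at r'
  simp only [toAny] at hp hq
  obtain ⟨rfl, hp⟩ := Sigma.mk.inj_iff.1 hp
  obtain ⟨rfl, hp⟩ := Sigma.mk.inj_iff.1 (eq_of_heq hp)
  obtain ⟨rfl, hq⟩ := Sigma.mk.inj_iff.1 hq
  obtain ⟨rfl, hq⟩ := Sigma.mk.inj_iff.1 (eq_of_heq hq)
  rw [eq_of_heq hp, eq_of_heq hq]

theorem mem_pairWWtensorBB (C : Collection) :
    Mem C [] [(white, (Sum.inl 0 : ℕ ⊕ ℕ)), (white, Sum.inl 0), (black, Sum.inr 0),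
      (black, Sum.inr 0)] ↔ pairWWtensorBB ∈ C 0 4 := by
  have h : toAny pairWWtensorBB = toAny (ofLists [] [(white, (Sum.inl 0 : ℕ ⊕ ℕ)),
      (white, Sum.inl 0), (black, Sum.inr 0), (black, Sum.inr 0)]) :=
    toAny_tensor_of_eq (toAny_ofWord ![white, white] fun _ => 0)
      (toAny_ofWord ![black, black] fun _ => 0)
  exact (mem_of_toAny_eq h).symm

theorem IsGlobCategory.word_glob (hC : IsGlobCategory C) (c : Color) {x y : α} (hxy : x ≠ y) :
    Mem C [] [(c, x), (c, x), (c.bar, y), (c.bar, y)] := by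
  have h := (mem_pairWWtensorBB C).2 hC.glob
  have key : ∀ x y : α, x ≠ y → Mem C [] [(white, x), (white, x), (black, y), (black, y)] := by
    intro x y hxy
    have := (word_mapLetters (C := C) (W := [(white, (Sum.inl 0 : ℕ ⊕ ℕ)), (white, Sum.inl 0),
      (black, Sum.inr 0), (black, Sum.inr 0)]) (Sum.elim (fun _ => x) fun _ => y) ?_).2 h
    · simpa using this
    · simp [hxy, hxy.symm]
  cases c
  · exact key x y hxy
  · exact hC.toIsCategory.word_rotate_append (U := [_, _]) (V := [_, _]) (key y x hxy.symm)

/-- In a globally colorized category, adjacent points of opposite colors may exchange their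
colors. -/
theorem IsGlobCategory.word_swap (hC : IsGlobCategory C) {c : Color} {a b : α}
    {U V : List (Color × α)} (h : Mem C [] (U ++ (c, a) :: (c.bar, b) :: V)) :
    Mem C [] (U ++ (c.bar, a) :: (c, b) :: V) := by
  classical
  have hC' := hC.toIsCategory
  -- the two pairs are inserted between the two points and joined to their neighbors
  have h1 : Mem C [] (((c.bar, b) :: V ++ U) ++ [(c, a)]) := by
    have := hC'.word_rotate_append (U := U ++ [(c, a)]) (V := (c.bar, b) :: V) (by simpa using h)
    simpa using this
  have h2 := hC'.mem_append ((word_mapLetters (C := C) (Sum.inl : α → α ⊕ Bool) (by simp)).2 h1)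
    (hC.word_glob c.bar (x := (Sum.inr true : α ⊕ Bool)) (y := Sum.inr false) (by simp)) (by simp)
  have h3 := hC'.word_cap_mid (c := c) (a := Sum.inl a) (b := Sum.inr true)
    (U := mapLetters Sum.inl ((c.bar, b) :: V ++ U))
    (V := [(c.bar, Sum.inr true), (c, Sum.inr false), (c, Sum.inr false)]) (by simpa using h2)
  have e : (fun z : α ⊕ Bool => if z = Sum.inr true then Sum.inl a else z) ∘ Sum.inl = Sum.inl := by
    funext z; simp
  have h4 := hC'.word_rotate_append
    (U := mapLetters Sum.inl ((c.bar, b) :: V ++ U) ++ [(c.bar, Sum.inl a), (c, Sum.inr false)])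
    (V := [(c, (Sum.inr false : α ⊕ Bool))]) (by simpa [e] using h3)
  have h5 := hC'.word_cap (c := c) (a := Sum.inr false) (b := Sum.inl b)
    (W := mapLetters Sum.inl (V ++ U) ++ [(c.bar, Sum.inl a), (c, Sum.inr false)])
    (by simpa using h4)
  have h6 := (word_mapLetters (C := C) (W := V ++ U ++ [(c.bar, a), (c, b)])
    ((fun z : α ⊕ Bool => if z = Sum.inl b then Sum.inr false else z) ∘ Sum.inl) ?_).1 ?_
  · have := hC'.word_rotate_append (U := V) (V := U ++ [(c.bar, a), (c, b)]) (by simpa using h6)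
    simpa using this
  · intro x _ y _ hxy
    by_cases hx : x = b <;> by_cases hy : y = b <;> simp_all
  · simpa using h5

/-- The degree of a color: `1` for white, `-1` for black. -/
def Color.deg : Color → ℤ
  | white => 1
  | black => -1

@[simp] theorem Color.deg_bar (c : Color) : c.bar.deg = -c.deg := by cases c <;> rfl

/-- The degree of a word: the number of white points minus the number of black points. -/
def deg (W : List (Color × α)) : ℤ := (W.map fun x => x.1.deg).sum

@[simp] theorem deg_nil : deg ([] : List (Color × α)) = 0 := rfl
@[simp] theorem deg_cons (x : Color × α) (W : List (Color × α)) :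
    deg (x :: W) = x.1.deg + deg W := by simp [deg]
@[simp] theorem deg_append (V W : List (Color × α)) : deg (V ++ W) = deg V + deg W := by
  simp [deg]
@[simp] theorem deg_mapLetters (F : α → β) (W : List (Color × α)) :
    deg (mapLetters F W) = deg W := by
  simp [deg, mapLetters, Function.comp_def]
@[simp] theorem deg_tilde (W : List (Color × α)) : deg (tilde W) = -deg W := by
  induction W with
  | nil => rfl
  | cons x W ih => obtain ⟨c, a⟩ := x; simp [ih, add_comm]

theorem deg_eq_count (W : List (Color × α)) :
    deg W = (W.map Prod.fst).count white - (W.map Prod.fst).count black := by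
  induction W with
  | nil => rfl
  | cons x W ih =>
    obtain ⟨c, a⟩ := x
    cases c <;> simp [ih, Color.deg] <;> ring

theorem length_eq_count (W : List (Color × α)) :
    W.length = (W.map Prod.fst).count white + (W.map Prod.fst).count black := by
  induction W with
  | nil => rfl
  | cons x W ih =>
    obtain ⟨c, a⟩ := x
    cases c <;> simp [ih] <;> ring

theorem even_length_iff (W : List (Color × α)) : Even W.length ↔ Even (deg W) := by
  rw [deg_eq_count, length_eq_count]
  simp [← Int.even_coe_nat, Int.even_add, Int.even_sub]

theorem perm_colors {V W : List (Color × α)} (hl : V.length = W.length) (hd : deg V = deg W) :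
    (V.map Prod.fst).Perm (W.map Prod.fst) := by
  rw [List.perm_iff_count]
  rw [deg_eq_count, deg_eq_count] at hd
  rw [length_eq_count, length_eq_count] at hl
  rintro (_ | _) <;> omega

/-- The colors of a part of a word can be permuted. -/
theorem IsGlobCategory.word_perm (hC : IsGlobCategory C) {cs cs' : List Color}
    (h : cs.Perm cs') : ∀ (U : List (Color × α)) (w : List α), w.length = cs.length →
      Mem C [] (U ++ cs.zip w) → Mem C [] (U ++ cs'.zip w) := by
  induction h with
  | nil => exact fun U w _ h => h
  | cons c _ ih =>
    rintro U (_ | ⟨a, w⟩) hw hU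
    · simpa using hU
    · have := ih (U ++ [(c, a)]) w (by simpa using hw) (by simpa using hU)
      simpa using this
  | swap c d cs =>
    rintro U (_ | ⟨a, _ | ⟨b, w⟩⟩) hw hU
    · simpa using hU
    · simp at hw
    · by_cases hcd : c = d
      · simpa [hcd] using hU
      · obtain rfl : c = d.bar := by cases c <;> cases d <;> first | rfl | exact absurd rfl hcd
        simpa using hC.word_swap (c := d) (by simpa using hU)
  | trans h1 _ ih1 ih2 =>
    intro U w hw hU
    exact ih2 U w (hw.trans h1.length_eq) (ih1 U w hw hU)

theorem zip_letters (W : List (Color × α)) : (W.map Prod.fst).zip (letters W) = W := by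
  rw [letters, List.zip_map']
  simp

/-- In a globally colorized category, only the degree of the coloring matters. -/
theorem IsGlobCategory.word_recolor (hC : IsGlobCategory C) {V W : List (Color × α)}
    (hl : letters V = letters W) (hd : deg V = deg W) (h : Mem C [] V) : Mem C [] W := by
  have hlen : V.length = W.length := by simpa using congrArg List.length hl
  have := hC.word_perm (perm_colors hlen hd) [] (letters V) (by simp)
    (by simpa [zip_letters] using h)
  rw [hl] at this
  simpa [zip_letters] using this

/-- An uncolored word belongs to `C` in balanced coloring: one (in the globally colorized case:
every) coloring of the word with as many white as black points belongs to `C`. -/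
def Bal (C : Collection) (w : List α) : Prop :=
  ∃ W : List (Color × α), letters W = w ∧ deg W = 0 ∧ Mem C [] W

theorem Bal.of_mem {W : List (Color × α)} (h : Mem C [] W) (hd : deg W = 0) : Bal C (letters W) :=
  ⟨W, rfl, hd, h⟩

theorem IsGlobCategory.mem_of_bal (hC : IsGlobCategory C) {W : List (Color × α)}
    (h : Bal C (letters W)) (hd : deg W = 0) : Mem C [] W := by
  obtain ⟨V, hV, hV0, hVm⟩ := h
  exact hC.word_recolor hV (hV0.trans hd.symm) hVm

theorem Bal.even {w : List α} (h : Bal C w) : Even w.length := by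
  obtain ⟨W, rfl, hd, -⟩ := h
  rw [length_letters, even_length_iff, hd]
  exact Even.zero

theorem exists_balanced : ∀ {w : List α}, Even w.length →
    ∃ W : List (Color × α), letters W = w ∧ deg W = 0
  | [], _ => ⟨[], rfl, rfl⟩
  | [_], h => by simp at h
  | a :: b :: w, h => by
    obtain ⟨W, hW, hd⟩ := exists_balanced (w := w) (by simpa [Nat.even_add_one] using h)
    exact ⟨(white, a) :: (black, b) :: W, by simp [hW], by simp [hd, Color.deg]⟩

theorem letters_eq_append {W : List (Color × α)} {u v : List α} (h : letters W = u ++ v) :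
    ∃ U V, W = U ++ V ∧ letters U = u ∧ letters V = v :=
  List.map_eq_append_iff.1 h

theorem map_merge_eq_self [DecidableEq α] {a b : α} {l : List α} (h : b ∉ l) :
    l.map (fun z => if z = b then a else z) = l := by
  conv_rhs => rw [← List.map_id l]
  refine List.map_congr_left fun z hz => if_neg ?_
  rintro rfl
  exact h hz

namespace IsGlobCategory

/-- Joining two adjacent points identifies their letters; a balanced coloring can always be chosen
such that they have opposite colors. -/
theorem bal_cap [DecidableEq α] (hC : IsGlobCategory C) {u v : List α} {a b : α}
    (h : Bal C (u ++ a :: b :: v)) : Bal C ((u ++ v).map fun z => if z = b then a else z) := by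
  have he := h.even
  obtain ⟨W, hW, hd⟩ := exists_balanced (w := u ++ v)
    (by simp [Nat.even_add, Nat.even_add_one] at he ⊢; tauto)
  obtain ⟨U, V, rfl, rfl, rfl⟩ := letters_eq_append hW
  have h1 : Mem C [] (U ++ (white, a) :: (white.bar, b) :: V) :=
    hC.mem_of_bal (by simpa using h) (by simpa using hd)
  simpa using Bal.of_mem (hC.word_cap_mid h1) (by simpa using hd)

theorem bal_cap_self (hC : IsGlobCategory C) {u v : List α} {a : α}
    (h : Bal C (u ++ a :: a :: v)) : Bal C (u ++ v) := by
  classical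
  have := hC.bal_cap h
  have e : (fun z => if z = a then a else z) = (id : α → α) := by
    funext z; split_ifs with h <;> simp [h]
  simpa [e] using this

/-- Joining a singleton to its left neighbor removes both points. -/
theorem bal_cap_right (hC : IsGlobCategory C) {u v : List α} {a b : α}
    (h : Bal C (u ++ a :: b :: v)) (hb : b ∉ u ++ v) : Bal C (u ++ v) := by
  classical
  have := hC.bal_cap h
  rwa [map_merge_eq_self hb] at this

theorem bal_reverse (hC : IsGlobCategory C) {w : List α} (h : Bal C w) : Bal C w.reverse := by
  obtain ⟨W, rfl, hd, h⟩ := h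
  simpa using Bal.of_mem (hC.word_tilde h) (by simpa using hd)

theorem bal_rotate (hC : IsGlobCategory C) {u v : List α} (h : Bal C (u ++ v)) :
    Bal C (v ++ u) := by
  obtain ⟨W, hW, hd, h⟩ := h
  obtain ⟨U, V, rfl, rfl, rfl⟩ := letters_eq_append hW
  simpa using Bal.of_mem (hC.word_rotate_append h) (by simpa [add_comm] using hd)

theorem bal_append (hC : IsGlobCategory C) {u v : List α} (hu : Bal C u) (hv : Bal C v)
    (huv : ∀ a ∈ u, a ∉ v) : Bal C (u ++ v) := by
  obtain ⟨U, rfl, hd, hU⟩ := hu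
  obtain ⟨V, rfl, hd', hV⟩ := hv
  simpa using Bal.of_mem (hC.mem_append hU hV (by simpa using huv)) (by simp [hd, hd'])

theorem bal_insert (hC : IsGlobCategory C) {u t v : List α} (h : Bal C (u ++ v)) (ht : Bal C t)
    (hd : ∀ a ∈ t, a ∉ u ++ v) : Bal C (u ++ t ++ v) := by
  have h1 := hC.bal_rotate h
  have h2 := hC.bal_append h1 ht fun a ha ha' => hd a ha' (by simpa [or_comm] using ha)
  have := hC.bal_rotate (u := v) (v := u ++ t) (by simpa using h2)
  simpa using this

theorem bal_pair (hC : IsGlobCategory C) (a : α) : Bal C [a, a] :=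
  Bal.of_mem (hC.mem_pair white a) (by simp)

theorem bal_nil (hC : IsGlobCategory C) : Bal C ([] : List α) :=
  Bal.of_mem hC.mem_nil rfl

end IsGlobCategory

/-- Renaming letters injectively. -/
theorem bal_map {w : List α} (F : α → β) (hF : ∀ a ∈ w, ∀ b ∈ w, F a = F b → a = b) :
    Bal C (w.map F) ↔ Bal C w := by
  constructor
  · rintro ⟨W, hW, hd, h⟩
    have hlen : w.length = W.length := by simpa using (congrArg List.length hW).symm
    obtain ⟨V, h1, rfl⟩ : ∃ V, letters V = w ∧ mapLetters F V = W := by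
      refine ⟨(W.map Prod.fst).zip w, ?_, ?_⟩
      · rw [letters, List.map_snd_zip (by simp [hlen])]
      · conv_rhs => rw [← zip_letters W, hW, List.zip_map_right]
        rfl
    exact ⟨V, h1, by simpa using hd, (word_mapLetters F (by rwa [h1])).1 h⟩
  · rintro ⟨W, rfl, hd, h⟩
    simpa using Bal.of_mem ((word_mapLetters F hF).2 h) (by simpa using hd)

theorem bal_map_injective {w : List α} {F : α → β} (hF : Function.Injective F) :
    Bal C (w.map F) ↔ Bal C w :=
  bal_map F fun _ _ _ _ h => hF h

namespace IsGlobCategory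

theorem bal_sum (hC : IsGlobCategory C) {u : List α} {v : List β} (hu : Bal C u) (hv : Bal C v) :
    Bal C (u.map Sum.inl ++ v.map Sum.inr) :=
  hC.bal_append ((bal_map_injective Sum.inl_injective).2 hu)
    ((bal_map_injective Sum.inr_injective).2 hv) (by simp)

/-- The uncolored form of `IsCategory.word_double`. -/
theorem bal_double [DecidableEq α] (hC : IsGlobCategory C) {x v : List α} (h : Bal C (x ++ v)) :
    Bal C (x.reverse.map Sum.inl ++
      x.map fun a => if a ∈ v then (Sum.inl a : α ⊕ α) else Sum.inr a) := by
  obtain ⟨W, hW, hd, h⟩ := h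
  obtain ⟨X, V, rfl, rfl, rfl⟩ := letters_eq_append hW
  simpa using Bal.of_mem (hC.word_double h) (by simp)

/-- A consecutive part of a word whose letters do not occur elsewhere can be removed, or be reduced
to a singleton, depending on the parity of its length. -/
theorem bal_collapse (hC : IsGlobCategory C) {u v : List α} : ∀ (n : ℕ) (x : List α),
    x.length = n → Bal C (u ++ x ++ v) → (∀ a ∈ x, a ∉ u ++ v) →
    (Even n → Bal C (u ++ v)) ∧ (Odd n → ∃ a ∈ x, Bal C (u ++ a :: v)) := by
  classical
  intro n
  induction n using Nat.strong_induction_on with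
  | _ n ih =>
    rintro (_ | ⟨p, _ | ⟨q, x⟩⟩) hn h hx
    · obtain rfl : n = 0 := by simpa using hn.symm
      exact ⟨fun _ => by simpa using h, fun h => by simp at h⟩
    · obtain rfl : n = 1 := by simpa using hn.symm
      exact ⟨fun h => by simp at h, fun _ => ⟨p, by simp, by simpa using h⟩⟩
    · have hn' : n = x.length + 2 := by simpa using hn.symm
      have hq : q ∉ u ++ v := hx q (by simp)
      have h1 := hC.bal_cap (u := u) (v := x ++ v) (by simpa using h)
      rw [List.map_append, List.map_append, map_merge_eq_self (l := u) fun h => hq (by simp [h]),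
        map_merge_eq_self (l := v) fun h => hq (by simp [h]), ← List.append_assoc] at h1
      have hsub : ∀ a ∈ x.map (fun z => if z = q then p else z), a ∈ p :: q :: x := by
        intro a ha
        obtain ⟨z, hz, rfl⟩ := List.mem_map.1 ha
        split_ifs <;> simp [hz]
      have := ih x.length (by omega) _ (by simp) h1 fun a ha => hx a (hsub a ha)
      refine ⟨fun he => this.1 ?_, fun ho => ?_⟩
      · rw [hn'] at he; simpa [Nat.even_add] using he
      · obtain ⟨a, ha, h⟩ := this.2 (by rw [hn'] at ho; simpa [Nat.odd_add] using ho)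
        exact ⟨a, hsub a ha, h⟩

end IsGlobCategory
end

/-! ### Noncrossing words and the words they yield -/

section
variable {α β γ : Type} {C D : Collection}

/-- A word is noncrossing if no two different letters alternate in it. -/
def NC (w : List α) : Prop := ∀ a b, [a, b, a, b].Sublist w → a = b

theorem NC.sublist {v w : List α} (hw : NC w) (h : v.Sublist w) : NC v :=
  fun a b hab => hw a b (hab.trans h)

theorem NC.cons {a : α} {w : List α} (hw : NC w) (ha : a ∉ w) : NC (a :: w) := by
  intro x y h
  rcases List.sublist_cons_iff.1 h with h | ⟨r, hr, h⟩
  · exact hw x y h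
  · obtain ⟨rfl, rfl⟩ := List.cons.inj hr
    exact absurd (h.subset (by simp)) ha

theorem three_sublist_replicate {a : α} {s : ℕ} (hs : 3 ≤ s) :
    [a, a, a].Sublist (List.replicate s a) :=
  (List.replicate_sublist_replicate (m := 3) a).2 hs

theorem NC.append_of_nodup {l w : List α} (hw : NC w) (hl : l.Nodup) (hd : ∀ a ∈ l, a ∉ w) :
    NC (l ++ w) := by
  induction l with
  | nil => exact hw
  | cons a l ih =>
    simp only [List.nodup_cons, List.mem_cons, forall_eq_or_imp] at hl hd
    exact (ih hl.2 hd.2).cons (by simp [hl.1, hd.1])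

theorem NC.of_map {F : α → β} (hF : Function.Injective F) {w : List α} (h : NC (w.map F)) :
    NC w := fun a b hab => hF (h _ _ (by simpa using hab.map F))

theorem Noncrossing.nc (hC : Noncrossing C) {W : List (Color × α)} (h : Mem C [] W) :
    NC (letters W) := by
  intro a b hab
  obtain ⟨f, hf⟩ := List.sublist_iff_exists_fin_orderEmbedding_get_eq.1 hab
  have hlen : (letters W).length = W.length := length_letters W
  let p : Fin 4 → Fin 0 ⊕ Fin W.length := fun i => Sum.inr (Fin.cast hlen (f i))
  have hlab : ∀ i : Fin 4, (W.get (Fin.cast hlen (f i))).2 = [a, b, a, b].get i := by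
    intro i
    rw [hf i]
    simp only [List.get_eq_getElem, letters, List.getElem_map]
    rfl
  have hlt : ∀ i j : Fin 4, i < j → pos (k := ([] : List (Color × α)).length) (p i) < pos (p j) := by
    intro i j hij
    have : f i < f j := f.lt_iff_lt.2 hij
    simpa [pos, p] using this
  have := hC _ _ _ h (p 0) (p 1) (p 2) (p 3) (hlt _ _ (by decide)) (hlt _ _ (by decide))
    (hlt _ _ (by decide)) ((hlab 0).trans (hlab 2).symm) ((hlab 1).trans (hlab 3).symm)
  exact (hlab 0).symm.trans (Eq.trans this (hlab 1))

theorem Noncrossing.nc_of_bal (hC : Noncrossing C) {w : List α} (h : Bal C w) : NC w := by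
  obtain ⟨W, rfl, -, h⟩ := h
  exact hC.nc h

/-- Between two consecutive occurrences of a letter of a noncrossing word, no letter of the
remaining word occurs. -/
theorem NC.notMem_of_mem_between {a : α} {u x y : List α} (h : NC (u ++ a :: x ++ a :: y))
    (hax : a ∉ x) {b : α} (hb : b ∈ x) : b ∉ u ∧ b ∉ y := by
  obtain ⟨x1, x2, rfl⟩ := List.append_of_mem hb
  have hab : a ≠ b := fun e => hax (e ▸ hb)
  constructor
  · intro hu
    refine hab (h b a ?_).symm
    obtain ⟨u1, u2, rfl⟩ := List.append_of_mem hu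
    have : [b, a, b, a] = [] ++ ([b] ++ ([] ++ ([a] ++ ([] ++ ([b] ++ ([] ++ ([a] ++ []))))))) := rfl
    rw [this, show u1 ++ b :: u2 ++ a :: (x1 ++ b :: x2) ++ a :: y =
      u1 ++ ([b] ++ (u2 ++ ([a] ++ (x1 ++ ([b] ++ (x2 ++ ([a] ++ y))))))) by simp]
    repeat' first
      | exact List.nil_sublist _ | exact List.Sublist.refl _ | apply List.Sublist.append
  · intro hy
    refine hab (h a b ?_)
    obtain ⟨y1, y2, rfl⟩ := List.append_of_mem hy
    have : [a, b, a, b] = [] ++ ([a] ++ ([] ++ ([b] ++ ([] ++ ([a] ++ ([] ++ ([b] ++ []))))))) := rfl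
    rw [this, show u ++ a :: (x1 ++ b :: x2) ++ a :: (y1 ++ b :: y2) =
      u ++ ([a] ++ (x1 ++ ([b] ++ (x2 ++ ([a] ++ (y1 ++ ([b] ++ y2))))))) by simp]
    repeat' first
      | exact List.nil_sublist _ | exact List.Sublist.refl _ | apply List.Sublist.append

/-- Every nonempty noncrossing word has a block that consists of consecutive points. -/
theorem NC.exists_interval : ∀ (n : ℕ) (w : List α), w.length = n → NC w → w ≠ [] →
    ∃ u a s v, w = u ++ List.replicate (s + 1) a ++ v ∧ a ∉ u ∧ a ∉ v := by
  intro n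
  induction n using Nat.strong_induction_on with
  | _ n ih =>
    rintro (_ | ⟨a, t⟩) hn hw h0
    · exact absurd rfl h0
    · by_cases hat : a ∈ t
      · -- an interval block of the part enclosed by the first two occurrences of `a` is one of `w`;
        -- if that part is empty, then one of the two occurrences is dropped
        obtain ⟨t1, t2, rfl, ha1⟩ := List.eq_append_cons_of_mem hat
        rcases t1 with _ | ⟨b, t1⟩
        · obtain ⟨u, c, s, v, he, hu, hv⟩ := ih (t2.length + 1) (by simp at hn; omega) (a :: t2)
            (by simp) (hw.sublist (by simp)) (by simp)
          rcases u with _ | ⟨d, u⟩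
          · obtain ⟨rfl, rfl⟩ : a = c ∧ t2 = List.replicate s c ++ v := by
              simpa [List.replicate_succ] using he
            exact ⟨[], a, s + 1, v, by simp [List.replicate_succ], by simp, hv⟩
          · obtain ⟨rfl, rfl⟩ : a = d ∧ t2 = u ++ List.replicate (s + 1) c ++ v := by
              simpa using he
            exact ⟨a :: a :: u, c, s, v, by simp, by simpa using hu, hv⟩
        · obtain ⟨u, c, s, v, he, hu, hv⟩ := ih (t1.length + 1) (by simp at hn; omega) (b :: t1)
            (by simp) (hw.sublist (by
              exact (List.sublist_append_left (b :: t1) (a :: t2)).trans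
                (List.sublist_cons_self _ _))) (by simp)
          have hc : c ∈ b :: t1 := by rw [he]; simp
          have hcy := (NC.notMem_of_mem_between (u := []) (by simpa using hw) ha1 hc).2
          have hca : c ≠ a := fun e => ha1 (e ▸ hc)
          exact ⟨a :: u, c, s, v ++ a :: t2, by rw [he]; simp, by simp [hu, hca],
            by simp [hv, hca, hcy]⟩
      · exact ⟨[], a, 0, t, by simp, by simp, hat⟩

/-- In a noncrossing word with blocks of size at most two, two adjacent points form a block, or two
adjacent points are singletons, or a singleton is enclosed by a block of size two, unless there is
only one point. -/
theorem NC.exists_local : ∀ (n : ℕ) (w : List α), w.length = n → NC w → w ≠ [] →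
    (∀ a, ¬ [a, a, a].Sublist w) →
    (∃ u x v, w = u ++ x :: x :: v ∧ x ∉ u ++ v) ∨
    (∃ u x y v, w = u ++ x :: y :: v ∧ x ≠ y ∧ x ∉ u ++ v ∧ y ∉ u ++ v) ∨
    (∃ u x y v, w = u ++ x :: y :: x :: v ∧ x ≠ y ∧ x ∉ u ++ v ∧ y ∉ u ++ v) ∨
    ∃ a, w = [a] := by
  intro n
  induction n using Nat.strong_induction_on with
  | _ n ih =>
    rintro (_ | ⟨a, t⟩) hn hw h0 hcount
    · exact absurd rfl h0
    -- enlarging a word by letters that do not occur in it preserves the first three cases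
    have lift : ∀ t1 t2 : List α, a :: t = a :: t1 ++ t2 → t1 ≠ [] → a ∉ t1 →
        (∀ b ∈ t1, b ∉ t2) → (∀ b, t1 ≠ [b]) →
        ((∃ u x v, a :: t = u ++ x :: x :: v ∧ x ∉ u ++ v) ∨
        (∃ u x y v, a :: t = u ++ x :: y :: v ∧ x ≠ y ∧ x ∉ u ++ v ∧ y ∉ u ++ v) ∨
        (∃ u x y v, a :: t = u ++ x :: y :: x :: v ∧ x ≠ y ∧ x ∉ u ++ v ∧ y ∉ u ++ v)) := by
      intro t1 t2 he h1 ha hd hs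
      rw [he]
      have hsub : t1.Sublist (a :: t) := by
        rw [he]; simp
      have hx : ∀ x ∈ t1, x ≠ a := fun x hx e => ha (e ▸ hx)
      have hlt : t1.length < n := by
        rw [← hn, he]; simp
      rcases ih _ hlt t1 rfl (hw.sublist hsub) h1
        (fun b h => hcount b (h.trans hsub)) with
        ⟨u, x, v, rfl, hxuv⟩ | ⟨u, x, y, v, rfl, hxy, hxuv, hyuv⟩ |
          ⟨u, x, y, v, rfl, hxy, hxuv, hyuv⟩ | ⟨b, rfl⟩
      · have h2 := hd x (by simp)
        have h3 := hx x (by simp)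
        exact Or.inl ⟨a :: u, x, v ++ t2, by simp, by simp at hxuv ⊢; tauto⟩
      · have h2 := hd x (by simp)
        have h3 := hx x (by simp)
        have h4 := hd y (by simp)
        have h5 := hx y (by simp)
        exact Or.inr (Or.inl ⟨a :: u, x, y, v ++ t2, by simp, hxy, by simp at hxuv ⊢; tauto,
          by simp at hyuv ⊢; tauto⟩)
      · have h2 := hd x (by simp)
        have h3 := hx x (by simp)
        have h4 := hd y (by simp)
        have h5 := hx y (by simp)
        exact Or.inr (Or.inr ⟨a :: u, x, y, v ++ t2, by simp, hxy, by simp at hxuv ⊢; tauto,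
          by simp at hyuv ⊢; tauto⟩)
      · exact absurd rfl (hs b)
    by_cases hat : a ∈ t
    · obtain ⟨t1, t2, rfl, ha1⟩ := List.eq_append_cons_of_mem hat
      have ha2 : a ∉ t2 := by
        intro h
        refine hcount a ?_
        simp [h]
      have hd : ∀ b ∈ t1, b ∉ t2 := fun b hb =>
        (NC.notMem_of_mem_between (u := []) (by simpa using hw) ha1 hb).2
      rcases t1 with _ | ⟨b, _ | ⟨c, t1⟩⟩
      · exact Or.inl ⟨[], a, t2, by simp, by simpa using ha2⟩
      · refine Or.inr (Or.inr (Or.inl ⟨[], a, b, t2, by simp, ?_, by simpa using ha2, ?_⟩))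
        · rintro rfl; simp at ha1
        · simpa using hd b (by simp)
      · have := lift (b :: c :: t1) (a :: t2) (by simp) (by simp) ha1 (fun x hx => ?_) (by simp)
        · rcases this with h | h | h
          exacts [Or.inl h, Or.inr (Or.inl h), Or.inr (Or.inr (Or.inl h))]
        · have := hd x hx
          have h3 : x ≠ a := fun e => ha1 (e ▸ hx)
          simp [h3, this]
    · rcases t with _ | ⟨b, _ | ⟨c, t⟩⟩
      · exact Or.inr (Or.inr (Or.inr ⟨a, rfl⟩))
      · refine Or.inr (Or.inl ⟨[], a, b, [], by simp, ?_, by simp, by simp⟩)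
        rintro rfl; simp at hat
      · have := lift (b :: c :: t) [] (by simp) (by simp) hat (by simp) (by simp)
        rcases this with h | h | h
        exacts [Or.inl h, Or.inr (Or.inl h), Or.inr (Or.inr (Or.inl h))]

/-! ### Special words -/

theorem bal_two {a b : α} (h : a ≠ b) : Bal C [a, b] ↔ Bal C [0, 1] := by
  rw [← bal_map (w := [0, 1]) (fun n => if n = 0 then a else b) (by simp [h, h.symm])]
  simp

theorem bal_four (a : α) : Bal C [a, a, a, a] ↔ Bal C [0, 0, 0, 0] := by
  rw [← bal_map (w := [0, 0, 0, 0]) (fun _ => a) (by simp)]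
  simp

theorem bal_positioner {a b c : α} (hab : a ≠ b) (hac : a ≠ c) (hbc : b ≠ c) :
    Bal C [a, b, c, b] ↔ Bal C [0, 1, 2, 1] := by
  rw [← bal_map (w := [0, 1, 2, 1]) (fun n => if n = 0 then a else if n = 1 then b else c)
    (by simp [hab, hab.symm, hac, hac.symm, hbc, hbc.symm])]
  simp

namespace IsGlobCategory

/-- A singleton yields the word of two singletons. -/
theorem bal_two_of_singleton (hC : IsGlobCategory C) {u v : List α} {a : α}
    (h : Bal C (u ++ a :: v)) (ha : a ∉ u ++ v) : Bal C [0, 1] := by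
  classical
  have h1 := hC.bal_double (x := [a]) (v := v ++ u) (by simpa using hC.bal_rotate h)
  rw [List.map_singleton, if_neg (by simpa [or_comm] using ha)] at h1
  exact (bal_two (by simp)).1 h1

/-- A block of size three next to a singleton yields the block of size four: in the product with
its reflection, the two singletons can be joined, and then two of the remaining points. -/
theorem bal_four_of_three_add_one (hC : IsGlobCategory C) {a b : α} (hab : a ≠ b)
    (h : Bal C [a, a, b, a]) : Bal C [0, 0, 0, 0] := by
  classical
  have h1 : Bal C [a, a, a, b] := hC.bal_rotate (u := [a, a, b]) (v := [a]) h
  have h2 : Bal C [Sum.inl a, Sum.inl a, Sum.inl a, Sum.inl b, Sum.inr b, Sum.inr a, Sum.inr a,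
      (Sum.inr a : α ⊕ α)] := hC.bal_sum h1 (hC.bal_reverse h1)
  have h3 := hC.bal_cap_right (u := [Sum.inl a, Sum.inl a, Sum.inl a])
    (v := [Sum.inr a, Sum.inr a, (Sum.inr a : α ⊕ α)]) h2 (by simp [hab.symm])
  have h4 := hC.bal_cap (u := [Sum.inl a, Sum.inl a]) (v := [Sum.inr a, (Sum.inr a : α ⊕ α)]) h3
  exact (bal_four (Sum.inl a : α ⊕ α)).1 (by simpa using h4)

/-- A block of size at least three in a noncrossing category yields the block of size four: the
part of the word between two consecutive points of the block is separated from the rest, so doubling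
gives a block of size four that encloses two copies of that part. If these cannot be removed
completely, then they can be reduced to singletons, and these can be removed together with some of
the points of the block. -/
theorem bal_four_of_three_sublist (hC : IsGlobCategory C) {w : List α} {a : α}
    (h : Bal C w) (hw : NC w) (ha : [a, a, a].Sublist w) : Bal C [0, 0, 0, 0] := by
  classical
  have ha := List.replicate_sublist_iff.1 (show (List.replicate 3 a).Sublist w from ha)
  obtain ⟨u, w1, rfl, hau⟩ :=
    List.eq_append_cons_of_mem (List.count_pos_iff.1 (by omega : 0 < w.count a))
  rw [List.count_append, List.count_eq_zero_of_not_mem hau, List.count_cons_self] at ha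
  obtain ⟨x, y, rfl, hax⟩ :=
    List.eq_append_cons_of_mem (List.count_pos_iff.1 (by omega : 0 < w1.count a))
  rw [List.count_append, List.count_eq_zero_of_not_mem hax, List.count_cons_self] at ha
  have hay : a ∈ y := List.count_pos_iff.1 (by omega : 0 < y.count a)
  have h1 : Bal C ((a :: x ++ [a]) ++ (y ++ u)) := by
    have := hC.bal_rotate (u := u) (v := a :: (x ++ a :: y)) h
    simpa using this
  have hsep : ∀ b ∈ x, b ∉ y ++ u := fun b hb => by
    have := NC.notMem_of_mem_between (u := u) (y := y) (by simpa using hw) hax hb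
    simp [this]
  have h2 := hC.bal_double h1
  have e : x.map (fun b => if b ∈ y ++ u then (Sum.inl b : α ⊕ α) else Sum.inr b) =
      x.map Sum.inr := List.map_congr_left fun b hb => if_neg (hsep b hb)
  have h3 : Bal C ([Sum.inl a] ++ x.reverse.map Sum.inl ++ ([Sum.inl a, Sum.inl a] ++
      x.map Sum.inr ++ [(Sum.inl a : α ⊕ α)])) := by
    simp only [List.mem_append] at e
    simpa [e, hay] using h2
  have h4 := hC.bal_collapse _ _ rfl h3 (by simp; rintro b hb rfl; exact hax hb)
  rcases Nat.even_or_odd x.length with he | ho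
  · have h5 := hC.bal_collapse (u := [Sum.inl a] ++ [Sum.inl a, Sum.inl a])
      (v := [(Sum.inl a : α ⊕ α)]) _ (x.map Sum.inr) rfl
      (by simpa using h4.1 (by simpa using he)) (by simp)
    exact (bal_four (Sum.inl a : α ⊕ α)).1 (by simpa using h5.1 (by simpa using he))
  · obtain ⟨p, hp, h5⟩ := h4.2 (by simpa using ho)
    obtain ⟨p', hp', rfl⟩ : ∃ p' ∈ x, Sum.inl p' = p := by simpa using hp
    have hpa : p' ≠ a := fun e => hax (e ▸ hp')
    have h6 := hC.bal_collapse (u := [Sum.inl a] ++ Sum.inl p' :: [Sum.inl a, Sum.inl a])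
      (v := [(Sum.inl a : α ⊕ α)]) _ (x.map Sum.inr) rfl (by simpa using h5) (by simp)
    obtain ⟨q, hq, h7⟩ := h6.2 (by simpa using ho)
    obtain ⟨q', -, rfl⟩ : ∃ q' ∈ x, Sum.inr q' = q := by simpa using hq
    have h8 : Bal C [Sum.inl a, Sum.inl p', Sum.inl a, Sum.inl a, Sum.inr q', Sum.inl a] := by
      simpa using h7
    have h9 := hC.bal_cap_right (u := []) (v := [Sum.inl a, Sum.inl a, Sum.inr q', Sum.inl a])
      h8 (by simp [hpa])
    exact hC.bal_four_of_three_add_one (a := Sum.inl a) (b := Sum.inr q') (by simp) h9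

end IsGlobCategory
end

/-! ### Building balanced words -/

section
variable {α β γ : Type} {C D : Collection}

namespace IsGlobCategory

/-- With the block of size four at hand, a block can be enlarged by two points next to one of its
points. -/
theorem bal_grow (hC : IsGlobCategory C) (h4 : Bal C [0, 0, 0, 0]) {u v : List α} {a : α}
    (h : Bal C (u ++ a :: v)) : Bal C (u ++ a :: a :: a :: v) := by
  classical
  have h1 := hC.bal_insert (u := u.map some ++ [some a]) (v := v.map some)
    (t := [none, none, none, none]) (by
      have := (bal_map_injective (C := C) (Option.some_injective α)).2 h
      simpa using this) ((bal_four none).2 h4) (by simp)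
  have h2 := hC.bal_cap (u := u.map some) (a := some a) (b := none)
    (v := none :: none :: none :: v.map some) (by simpa using h1)
  refine (bal_map_injective (C := C) (Option.some_injective α)).1 ?_
  simpa [Function.comp_def] using h2

/-- An interval block can be enlarged by two points. -/
theorem bal_enlarge (hC : IsGlobCategory C) {u v : List α} {a : α} {s : ℕ}
    (h4 : s = 0 ∨ Bal C [0, 0, 0, 0]) (hu : a ∉ u) (hv : a ∉ v)
    (h : Bal C (u ++ List.replicate s a ++ v)) : Bal C (u ++ List.replicate (s + 2) a ++ v) := by
  rcases s with _ | s
  · have := hC.bal_insert (u := u) (v := v) (by simpa using h) (hC.bal_pair a)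
      (by simp [hu, hv])
    simpa [List.replicate_succ] using this
  · have := hC.bal_grow (h4.resolve_left (by simp)) (u := u) (a := a)
      (v := List.replicate s a ++ v) (by simpa [List.replicate_succ] using h)
    simpa [List.replicate_succ] using this

/-- The positioner word lets singletons move past their neighbors. -/
theorem bal_move (hC : IsGlobCategory C) (hp : Bal C [0, 1, 2, 1]) {u v : List α} {a c : α}
    (h : Bal C (u ++ a :: c :: v)) (ha : a ∉ u ++ c :: v) : Bal C (u ++ c :: a :: v) := by
  classical
  -- the positioner is inserted behind the two points; joining adjacent points then passes the string
  -- of `c` on and replaces `a` by a singleton on the other side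
  have ht : Bal C [(Sum.inr 1 : α ⊕ ℕ), Sum.inr 2, Sum.inr 1, Sum.inr 0] :=
    hC.bal_rotate (u := [Sum.inr 0]) (v := [Sum.inr 1, Sum.inr 2, Sum.inr 1])
      ((bal_positioner (a := (Sum.inr 0 : α ⊕ ℕ)) (by simp) (by simp) (by simp)).2 hp)
  have h1 := hC.bal_insert (u := u.map Sum.inl ++ [Sum.inl a, Sum.inl c]) (v := v.map Sum.inl) (by
      have := (bal_map_injective (C := C) (Sum.inl_injective (α := α) (β := ℕ))).2 h
      simpa using this) ht (by simp)
  have h2 := hC.bal_cap (u := u.map Sum.inl ++ [Sum.inl a]) (a := Sum.inl c) (b := Sum.inr 1)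
    (v := Sum.inr 2 :: Sum.inr 1 :: Sum.inr 0 :: v.map Sum.inl) (by simpa using h1)
  have h3 := hC.bal_cap_right (u := u.map Sum.inl) (a := Sum.inl a) (b := Sum.inr 2)
    (v := Sum.inl c :: Sum.inr 0 :: v.map Sum.inl)
    (by simpa [Function.comp_def] using h2) (by simp)
  have h4 := (bal_map (C := C) (Sum.elim id fun _ => a) ?_).2 h3
  · simpa using h4
  · simp only [List.mem_append, List.mem_cons, List.mem_map, not_or] at ha ⊢
    rintro (x | x) hx (y | y) hy hxy
    · simpa using hxy
    · obtain rfl : x = a := by simpa using hxy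
      exact absurd hx (by simpa using ha)
    · obtain rfl : a = y := by simpa using hxy
      exact absurd hy (by simpa using ha)
    · simp at hx hy
      rw [hx, hy]

theorem bal_move_far (hC : IsGlobCategory C) (hp : Bal C [0, 1, 2, 1]) {v : List α} {a : α} :
    ∀ (u t : List α), Bal C (t ++ a :: (u ++ v)) → a ∉ t ++ (u ++ v) → Bal C (t ++ u ++ a :: v)
  | [], t, h, _ => by simpa using h
  | c :: u, t, h, ha => by
    have h1 := hC.bal_move hp (u := t) (a := a) (c := c) (v := u ++ v) (by simpa using h)
      (by simpa using ha)
    have := bal_move_far hC hp u (t ++ [c]) (by simpa using h1) (by simpa using ha)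
    simpa using this

/-- If singletons can move freely, then all noncrossing words of even length can be constructed,
provided that the block of size four is present or not needed. Words of odd length are completed by
an additional singleton. -/
theorem bal_of_nc (hC : IsGlobCategory C) (hs : Bal C [0, 1])
    (hp : Bal C [0, 1, 2, 1]) :
    ∀ (n : ℕ) (w : List α), w.length = n → NC w →
      (Bal C [0, 0, 0, 0] ∨ ∀ a, ¬ [a, a, a].Sublist w) →
      (Even n → Bal C w) ∧ (Odd n → Bal C (none :: w.map some)) := by
  intro n
  induction n using Nat.strong_induction_on with
  | _ n ih =>
    intro w hn hw h4
    rcases eq_or_ne w [] with rfl | h0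
    · obtain rfl : n = 0 := by simpa using hn.symm
      exact ⟨fun _ => hC.bal_nil, fun h => by simp at h⟩
    obtain ⟨u, a, s, v, rfl, hu, hv⟩ := NC.exists_interval _ w rfl hw h0
    have hcount : ∀ l : List α, l.Sublist (u ++ List.replicate (s + 1) a ++ v) →
        (Bal C [0, 0, 0, 0] ∨ ∀ a, ¬ [a, a, a].Sublist l) := fun l hl =>
      h4.imp_right fun h b hb => h b (hb.trans hl)
    rcases s with _ | s
    · -- a singleton is moved to the front, where it is the additional singleton of the shorter
      -- word, or is paired with the additional singleton of the word itself
      have hsub : (u ++ v).Sublist (u ++ List.replicate (0 + 1) a ++ v) := by simp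
      have hn' : n = (u ++ v).length + 1 := by simp at hn ⊢; omega
      obtain ⟨h1, h2⟩ := ih _ (by omega) (u ++ v) rfl (hw.sublist hsub) (hcount _ hsub)
      refine ⟨fun he => ?_, fun ho => ?_⟩
      · have h3 := h2 (by rw [hn'] at he; simpa [Nat.even_add_one] using he)
        have h5 := (bal_map (C := C) (fun o : Option α => o.getD a) ?_).2 h3
        · have := hC.bal_move_far hp (v := v) (a := a) u [] (by simpa [Function.comp_def] using h5)
            (by simp [hu, hv])
          simpa using this
        · have hauv : a ∉ u ++ v := by simp [hu, hv]
          generalize u ++ v = l at hauv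
          rintro (_ | x) hx (_ | y) hy hxy
          · rfl
          · obtain rfl : a = y := hxy
            simp [hauv] at hy
          · obtain rfl : x = a := hxy
            simp [hauv] at hx
          · exact congrArg some hxy
      · have h3 := h1 (by rw [hn'] at ho; simpa [Nat.odd_add_one] using ho)
        have h5 := hC.bal_insert (u := []) (t := [none, some a])
          ((bal_map_injective (C := C) (Option.some_injective α)).2 h3)
          ((bal_two (by simp)).2 hs) (by
            simp only [List.mem_cons, List.not_mem_nil, or_false, List.nil_append, List.mem_map]
            rintro _ (rfl | rfl) ⟨x, hx, hxe⟩
            · simp at hxe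
            · obtain rfl : x = a := by simpa using hxe
              simp [hu, hv] at hx)
        have := hC.bal_move_far hp (v := v.map some) (a := some a) (u.map some) [none]
          (by simpa using h5) (by simp [hu, hv])
        simpa using this
    · -- two points of a larger interval block are inserted last
      have hn' : n = (u ++ List.replicate s a ++ v).length + 2 := by
        simp at hn ⊢; omega
      have hsub : (u ++ List.replicate s a ++ v).Sublist
          (u ++ List.replicate (s + 1 + 1) a ++ v) := by
        refine (List.Sublist.append_left ?_ u).append_right v
        exact List.replicate_sublist_replicate _ |>.2 (by omega)
      obtain ⟨h1, h2⟩ := ih _ (by omega) _ rfl (hw.sublist hsub) (hcount _ hsub)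
      have h4' : s = 0 ∨ Bal C [0, 0, 0, 0] := by
        rcases h4 with h4 | h4
        · exact Or.inr h4
        · refine Or.inl (by_contra fun hs0 => h4 a ?_)
          exact (three_sublist_replicate (s := s + 1 + 1) (by omega)).trans (by simp)
      refine ⟨fun he => ?_, fun ho => ?_⟩
      · exact hC.bal_enlarge h4' hu hv (h1 (by rw [hn'] at he; simpa [Nat.even_add] using he))
      · have h3 := h2 (by rw [hn'] at ho; simpa [Nat.odd_add] using ho)
        have := hC.bal_enlarge (u := none :: u.map some) (v := v.map some) (a := some a) h4'
          (by simp [hu]) (by simp [hv]) (by simpa using h3)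
        simpa using this

end IsGlobCategory

/-- A word that is a consecutive part of a balanced word of `C` and is not connected to the rest
of it. -/
def Part (C : Collection) (w : List α) : Prop :=
  ∃ (β : Type) (v : List β), Bal C (w.map Sum.inl ++ v.map Sum.inr)

theorem Part.of_mem (hC : IsCategory C) {W : List (Color × α)} (h : Mem C [] W) :
    Part C (letters W) :=
  ⟨α, letters (tilde W), by
    simpa using Bal.of_mem (hC.mem_sum h (hC.word_tilde h)) (by simp)⟩

theorem Part.nc (hC : Noncrossing C) {w : List α} (h : Part C w) : NC w := by
  obtain ⟨β, v, h⟩ := h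
  exact ((hC.nc_of_bal h).sublist (by simp)).of_map Sum.inl_injective

theorem Part.cap_self (hC : IsGlobCategory C) {u v : List α} {a : α}
    (h : Part C (u ++ a :: a :: v)) : Part C (u ++ v) := by
  obtain ⟨β, t, h⟩ := h
  refine ⟨β, t, ?_⟩
  have := hC.bal_cap_self (u := u.map Sum.inl) (v := v.map Sum.inl ++ t.map Sum.inr)
    (by simpa using h)
  simpa using this

theorem Part.cap_right (hC : IsGlobCategory C) {u v : List α} {a b : α}
    (h : Part C (u ++ a :: b :: v)) (hb : b ∉ u ++ v) : Part C (u ++ v) := by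
  obtain ⟨β, t, h⟩ := h
  refine ⟨β, t, ?_⟩
  have := hC.bal_cap_right (u := u.map Sum.inl) (v := v.map Sum.inl ++ t.map Sum.inr)
    (by simpa using h) (by simpa using hb)
  simpa using this

theorem Part.bal_two_of_singleton (hC : IsGlobCategory C) {u v : List α} {a : α}
    (h : Part C (u ++ a :: v)) (ha : a ∉ u ++ v) : Bal C [0, 1] := by
  obtain ⟨β, t, h⟩ := h
  exact hC.bal_two_of_singleton (u := u.map Sum.inl) (v := v.map Sum.inl ++ t.map Sum.inr)
    (a := Sum.inl a) (by simpa using h) (by simpa using ha)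

theorem Part.bal_four_of_three_sublist (hC : IsGlobCategory C)
    (hN : Noncrossing C) {w : List α} {a : α} (h : Part C w) (ha : [a, a, a].Sublist w) :
    Bal C [0, 0, 0, 0] := by
  obtain ⟨β, t, h⟩ := h
  refine hC.bal_four_of_three_sublist (a := Sum.inl a) h (hN.nc_of_bal h) ?_
  exact (ha.map (Sum.inl : α → α ⊕ β)).trans (List.sublist_append_left _ _)

/-- A singleton enclosed by a block of size two yields the positioner word. -/
theorem Part.bal_positioner (hC : IsGlobCategory C) {u v : List α} {x y : α}
    (h : Part C (u ++ x :: y :: x :: v)) (hxy : x ≠ y) (hx : x ∉ u ++ v) (hy : y ∉ u ++ v) :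
    Bal C [0, 1, 2, 1] := by
  classical
  obtain ⟨β, t, h⟩ := h
  have h1 := hC.bal_rotate (u := u.map Sum.inl)
    (v := [Sum.inl x, Sum.inl y, Sum.inl x] ++ v.map Sum.inl ++ t.map Sum.inr) (by simpa using h)
  have h2 := hC.bal_double (x := [Sum.inl x, Sum.inl y, Sum.inl x])
    (v := v.map Sum.inl ++ t.map Sum.inr ++ u.map Sum.inl) (by simpa using h1)
  simp only [List.mem_append, not_or] at hx hy
  have h3 : Bal C [Sum.inl (Sum.inl x), Sum.inl (Sum.inl y), Sum.inl (Sum.inl x),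
      Sum.inr (Sum.inl x), Sum.inr (Sum.inl y), (Sum.inr (Sum.inl x) : (α ⊕ β) ⊕ (α ⊕ β))] := by
    simpa [hx, hy] using h2
  have h4 := hC.bal_cap_right (u := [Sum.inl (Sum.inl x), Sum.inl (Sum.inl y), Sum.inl (Sum.inl x)])
    (v := [(Sum.inr (Sum.inl x) : (α ⊕ β) ⊕ (α ⊕ β))]) h3 (by simp [hxy.symm])
  have h5 := hC.bal_rotate (u := [Sum.inl (Sum.inl x), Sum.inl (Sum.inl y), Sum.inl (Sum.inl x)])
    (v := [(Sum.inr (Sum.inl x) : (α ⊕ β) ⊕ (α ⊕ β))]) h4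
  exact (TwoColored.bal_positioner (by simp) (by simp) (by simp [hxy])).1 h5

/-- Without singletons, all blocks have even size, and an interval block can be removed in `C` and
inserted again in `D`. -/
theorem Part.bal_of_no_singleton (hC : IsGlobCategory C) (hN : Noncrossing C)
    (hD : IsGlobCategory D) (hs : ¬ Bal C [0, 1])
    (h4 : Bal C [0, 0, 0, 0] → Bal D [0, 0, 0, 0]) :
    ∀ (n : ℕ) (w : List α), w.length = n → Part C w → Bal D w := by
  classical
  intro n
  induction n using Nat.strong_induction_on with
  | _ n ih =>
    intro w hn hw
    rcases eq_or_ne w [] with rfl | h0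
    · exact hD.bal_nil
    obtain ⟨u, a, s, v, rfl, hu, hv⟩ := NC.exists_interval _ w rfl (hw.nc hN) h0
    rcases s with _ | s
    · exact absurd (Part.bal_two_of_singleton hC (u := u) (v := v) (a := a) (by simpa using hw)
        (by simp [hu, hv])) hs
    · have h1 : Part C (u ++ List.replicate s a ++ v) := by
        have := Part.cap_self hC (u := u) (v := List.replicate s a ++ v) (a := a)
          (by simpa [List.replicate_succ] using hw)
        simpa using this
      refine hD.bal_enlarge ?_ hu hv (ih _ ?_ _ rfl h1)
      · rcases Nat.eq_zero_or_pos s with hs0 | hs0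
        · exact Or.inl hs0
        · refine Or.inr (h4 (Part.bal_four_of_three_sublist hC hN (a := a) hw ?_))
          exact (three_sublist_replicate (s := s + 1 + 1) (by omega)).trans (by simp)
      · simp at hn ⊢; omega

/-- With blocks of size at most two and without the positioner word, every word of even length
contains two adjacent singletons or two adjacent points of a block. -/
theorem Part.bal_of_no_positioner (hC : IsGlobCategory C) (hN : Noncrossing C)
    (hD : IsGlobCategory D) (hs : Bal D [0, 1]) (h4 : ¬ Bal C [0, 0, 0, 0])
    (hp : ¬ Bal C [0, 1, 2, 1]) :
    ∀ (n : ℕ) (w : List α), w.length = n → Even n → Part C w → Bal D w := by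
  classical
  intro n
  induction n using Nat.strong_induction_on with
  | _ n ih =>
    intro w hn he hw
    rcases eq_or_ne w [] with rfl | h0
    · exact hD.bal_nil
    have hcount : ∀ a, ¬ [a, a, a].Sublist w := fun a h =>
      h4 (Part.bal_four_of_three_sublist hC hN hw h)
    rcases NC.exists_local _ w rfl (hw.nc hN) h0 hcount with
      ⟨u, x, v, rfl, hx⟩ | ⟨u, x, y, v, rfl, hxy, hx, hy⟩ | ⟨u, x, y, v, rfl, hxy, hx, hy⟩ |
        ⟨a, rfl⟩
    · have hn' : n = (u ++ v).length + 2 := by simp at hn ⊢; omega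
      have h1 := ih _ (by omega) _ rfl (by rw [hn'] at he; simpa [Nat.even_add] using he)
        (hw.cap_self hC)
      simpa using hD.bal_insert h1 (hD.bal_pair x) (by simpa using hx)
    · have hn' : n = (u ++ v).length + 2 := by simp at hn ⊢; omega
      have h1 := ih _ (by omega) _ rfl (by rw [hn'] at he; simpa [Nat.even_add] using he)
        (hw.cap_right hC hy)
      simpa using hD.bal_insert h1 ((bal_two hxy).2 hs) 
        (by simpa using ⟨by simpa using hx, by simpa using hy⟩)
    · exact absurd (Part.bal_positioner hC hw hxy hx hy) hp
    · rw [← hn] at he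
      simp at he

namespace IsGlobCategory

/-- A word of odd length yields the word of two singletons. -/
theorem bal_two_of_odd (hC : IsGlobCategory C) {W : List (Color × α)} (h : Mem C [] W)
    (ho : Odd W.length) : Bal C [0, 1] := by
  have h1 : Bal C ([] ++ (letters W).map Sum.inl ++
      (letters (tilde W)).map (Sum.inr : α → α ⊕ α)) := by
    simpa using Bal.of_mem (hC.mem_sum h (hC.word_tilde h)) (by simp)
  obtain ⟨x, hx, h2⟩ := (hC.bal_collapse _ _ rfl h1 (by simp)).2 (by simpa using ho)
  obtain ⟨x', -, rfl⟩ : ∃ x' ∈ letters W, Sum.inl x' = x := by simpa using hx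
  have h3 : Bal C ([Sum.inl x'] ++ (letters (tilde W)).map (Sum.inr : α → α ⊕ α) ++ []) := by
    simpa using h2
  obtain ⟨y, hy, h4⟩ := (hC.bal_collapse _ _ rfl h3 (by simp)).2 (by simpa using ho)
  obtain ⟨y', -, rfl⟩ : ∃ y' ∈ letters W, Sum.inr y' = y := by simpa using hy
  exact (bal_two (by simp)).1 h4

/-- A word of odd length yields the positioner word: nest the word in a pair. -/
theorem bal_positioner_of_odd (hC : IsGlobCategory C) {W : List (Color × α)} (h : Mem C [] W)
    (ho : Odd W.length) : Bal C [0, 1, 2, 1] := by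
  have h1 : Bal C ([Sum.inl none] ++ (letters W).map (Sum.inl ∘ some) ++
      ([Sum.inl none] ++ (letters (tilde W)).map (Sum.inr : α → Option α ⊕ α))) := by
    simpa [Function.comp_def] using
      Bal.of_mem (hC.mem_sum (hC.word_nest white h) (hC.word_tilde h)) (by simp)
  obtain ⟨x, hx, h2⟩ := (hC.bal_collapse _ _ rfl h1 (by simp)).2 (by simpa using ho)
  obtain ⟨x', -, rfl⟩ : ∃ x' ∈ letters W, Sum.inl (some x') = x := by simpa using hx
  have h3 : Bal C ([Sum.inl none, Sum.inl (some x'), Sum.inl none] ++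
      (letters (tilde W)).map (Sum.inr : α → Option α ⊕ α) ++ []) := by
    simpa using h2
  obtain ⟨y, hy, h4⟩ := (hC.bal_collapse _ _ rfl h3 (by simp)).2 (by simpa using ho)
  obtain ⟨y', -, rfl⟩ : ∃ y' ∈ letters W, Sum.inr y' = y := by simpa using hy
  exact (bal_positioner (by simp) (by simp) (by simp)).1
    (hC.bal_rotate (u := [Sum.inl none, Sum.inl (some x'), Sum.inl none]) h4)

end IsGlobCategory
end

/-! ### Degrees, generators and the classification -/

section
variable {α β γ : Type} {C D : Collection}

namespace IsGlobCategory

/-- Cutting two points off the block of size four gives the positioner word. -/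
theorem bal_positioner_of_four (hC : IsGlobCategory C) (hs : Bal C [0, 1])
    (h4 : Bal C [0, 0, 0, 0]) : Bal C [0, 1, 2, 1] := by
  have h1 := hC.bal_insert (u := [0, 0]) (t := [1, 2]) (v := [0, 0]) h4
    ((bal_two (by simp)).2 hs) (by simp)
  have h2 := hC.bal_cap_right (u := [0]) (a := 0) (b := 1) (v := [2, 0, 0]) h1 (by simp)
  have h3 := hC.bal_insert (u := [0, 2, 0, 0]) (t := [3, 4]) (v := []) h2
    ((bal_two (by simp)).2 hs) (by simp)
  have h5 := hC.bal_cap_right (u := [0, 2, 0]) (a := 0) (b := 3) (v := [4]) h3 (by simp)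
  exact (bal_positioner (by simp) (by simp) (by simp)).1
    (hC.bal_rotate (u := [0, 2, 0]) (v := [4]) h5)

theorem bal_of_nodup (hC : IsGlobCategory C) (hs : Bal C [0, 1]) :
    ∀ {w : List α}, Even w.length → w.Nodup → Bal C w
  | [], _, _ => hC.bal_nil
  | [_], h, _ => by simp at h
  | a :: b :: w, h, hw => by
    simp only [List.nodup_cons, List.mem_cons, not_or] at hw
    have h1 := bal_of_nodup hC hs (w := w) (by simpa [Nat.even_add_one] using h) hw.2.2
    have := hC.bal_insert (u := []) h1 ((bal_two hw.1.1).2 hs) (by simp [hw])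
    simpa using this

theorem bal_replicate_even (hC : IsGlobCategory C) (h4 : Bal C [0, 0, 0, 0]) (a : α) :
    ∀ n, Bal C (List.replicate (n + n) a)
  | 0 => hC.bal_nil
  | n + 1 => by
    have h := bal_replicate_even hC h4 a n
    have := hC.bal_enlarge (u := []) (v := []) (a := a) (Or.inr h4) (by simp) (by simp)
      (by simpa using h)
    rw [show n + 1 + (n + 1) = n + n + 2 by omega]
    simpa using this

/-- A word of the category can be exchanged for any word of the same degree, provided that the
balanced word that consists of the reflection of the former and of the latter is present. -/
theorem mem_of_bal_reverse (hC : IsGlobCategory C) {V : List (Color × α)}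
    {W : List (Color × β)} (hV : Mem C [] V) (hd : deg V = deg W)
    (h : Bal C ((letters V).reverse.map Sum.inl ++ (letters W).map (Sum.inr : β → α ⊕ β))) :
    Mem C [] W :=
  hC.word_cancel hV (hC.mem_of_bal (by simpa using h) (by simp [hd]))

end IsGlobCategory

theorem Bal.mono (h : ∀ k l, C k l ⊆ D k l) {w : List α} (hw : Bal C w) : Bal D w := by
  obtain ⟨W, hW, hd, hm⟩ := hw
  exact ⟨W, hW, hd, h _ _ hm⟩

/-- A category is determined by its words. -/
theorem subset_of_words (hC : IsCategory C) (hD : IsCategory D)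
    (h : ∀ (α : Type) (W : List (Color × α)), Mem C [] W → Mem D [] W) (k l : ℕ) :
    C k l ⊆ D k l := by
  intro p hp
  rw [exists_eq_ofFns p, ← mem_ofFns_iff, hC.mem_iff_word] at hp
  rw [exists_eq_ofFns p, ← mem_ofFns_iff, hD.mem_iff_word]
  exact h _ _ hp

/-- The degrees of the words of a category form a subgroup of the integers. -/
def degGroup (hC : IsCategory C) : AddSubgroup ℤ where
  carrier := {d | ∃ (α : Type) (W : List (Color × α)), Mem C [] W ∧ deg W = d}
  zero_mem' := ⟨ℕ, [], hC.mem_nil, rfl⟩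
  add_mem' := by
    rintro _ _ ⟨α, V, hV, rfl⟩ ⟨β, W, hW, rfl⟩
    exact ⟨α ⊕ β, _, hC.mem_sum hV hW, by simp⟩
  neg_mem' := by
    rintro _ ⟨α, V, hV, rfl⟩
    exact ⟨α, _, hC.word_tilde hV, by simp⟩

theorem mem_degGroup (hC : IsCategory C) {W : List (Color × α)} (h : Mem C [] W) :
    deg W ∈ degGroup hC :=
  ⟨α, W, h, rfl⟩

theorem exists_degGroup_eq (hC : IsCategory C) :
    ∃ k : ℕ, degGroup hC = AddSubgroup.zmultiples (k : ℤ) := by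
  obtain ⟨a, ha⟩ := Int.subgroup_cyclic (degGroup hC)
  exact ⟨a.natAbs, by rw [ha, ← AddSubgroup.zmultiples_eq_closure, Int.zmultiples_natAbs]⟩

/-- The common core of all cases. Let `k` generate the group of degrees of `C`, let `G` generate a
globally colorized subcategory of `C`, and let `g` be a further partition of degree `k`. If the
words of `C`, and `g`, can be exchanged for words of `C` of the same degree by means of `G`, then
`C` is generated by `G` and `g`. -/
theorem eq_generated_insert (hC : IsGlobCategory C) {G : Set AnyColPart}
    (hG : ∀ g ∈ G, g.2.2 ∈ C g.1 g.2.1) (hGg : toAny pairWWtensorBB ∈ G) {k : ℕ}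
    (hk : degGroup hC.toIsCategory = AddSubgroup.zmultiples (k : ℤ)) {g : AnyColPart}
    {Wg : List (Color × γ)} (hg : g = toAny (ofLists [] Wg)) (hd : deg Wg = k)
    (h1 : ∀ (α β : Type) (V : List (Color × α)) (W : List (Color × β)), Mem C [] V → Mem C [] W →
      deg V = deg W →
      Bal (generated G) ((letters V).reverse.map Sum.inl ++
        (letters W).map (Sum.inr : β → α ⊕ β)))
    (h2 : ∀ (α : Type) (V : List (Color × α)), Mem C [] V → deg V = k →
      Bal (generated G) ((letters V).reverse.map Sum.inl ++
        (letters Wg).map (Sum.inr : γ → α ⊕ γ))) :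
    C = generated (insert g G) := by
  have hGC := generated_least G C hC.toIsCategory hG
  have hgC : Mem C [] Wg := by
    obtain ⟨α, V, hV, hVd⟩ : (k : ℤ) ∈ degGroup hC.toIsCategory := by
      rw [hk]; exact AddSubgroup.mem_zmultiples _
    exact hC.mem_of_bal_reverse hV (hVd.trans hd.symm) ((h2 α V hV hVd).mono hGC)
  have hDC : ∀ k l, generated (insert g G) k l ⊆ C k l := by
    refine generated_least _ C hC.toIsCategory ?_
    rintro g' (rfl | hg')
    · rw [hg]; exact hgC
    · exact hG g' hg'
  have hGD : ∀ k l, generated G k l ⊆ generated (insert g G) k l :=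
    generated_least G _ (isCategory_generated _) fun g' hg' =>
      mem_generated _ _ (Set.mem_insert_of_mem _ hg')
  have hD : IsGlobCategory (generated (insert g G)) :=
    { isCategory_generated _ with
      glob := mem_generated _ (toAny pairWWtensorBB) (Set.mem_insert_of_mem _ hGg) }
  have hgD : Mem (generated (insert g G)) [] Wg := by
    have := mem_generated (insert g G) g (Set.mem_insert _ _)
    subst hg
    exact this
  have hdeg : degGroup hC.toIsCategory ≤ degGroup hD.toIsCategory := by
    rw [hk, AddSubgroup.zmultiples_le, ← hd]
    exact mem_degGroup _ hgD
  have hCD : ∀ k l, C k l ⊆ generated (insert g G) k l := by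
    refine subset_of_words hC.toIsCategory hD.toIsCategory fun β W hW => ?_
    obtain ⟨α, V, hV, hVd⟩ := hdeg (mem_degGroup hC.toIsCategory hW)
    exact hD.mem_of_bal_reverse hV hVd ((h1 α β V W (hDC _ _ hV) hW hVd).mono hGD)
  funext k l
  exact Set.Subset.antisymm (hCD k l) (hDC k l)

/-! ### The generators -/

theorem fourWBWB_mem_iff (hC : IsGlobCategory C) :
    fourWBWB ∈ C 0 4 ↔ Bal C [0, 0, 0, 0] := by
  have h := mem_ofWord C ![white, black, white, black] fun _ => 0
  refine h.symm.trans ⟨fun h => ?_, fun h => hC.mem_of_bal ?_ ?_⟩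
  · exact Bal.of_mem h (by simp [Color.deg])
  · exact h
  · simp [Color.deg]

theorem positionerWWBB_mem_iff (hC : IsGlobCategory C) :
    positionerWWBB ∈ C 0 4 ↔ Bal C [0, 1, 2, 1] := by
  have h := mem_ofWord C ![white, white, black, black] ![0, 1, 2, 1]
  refine h.symm.trans ⟨fun h => ?_, fun h => hC.mem_of_bal ?_ ?_⟩
  · exact Bal.of_mem h (by simp [Color.deg])
  · exact h
  · simp [Color.deg]

theorem toAny_singleWtensorB : toAny singleWtensorB =
    toAny (ofLists [] [(white, (Sum.inl 0 : ℕ ⊕ ℕ)), (black, Sum.inr 0)]) :=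
  toAny_tensor_of_eq (toAny_ofWord ![white] fun _ => 0) (toAny_ofWord ![black] fun _ => 0)

theorem singleWtensorB_mem_iff (hC : IsGlobCategory C) :
    singleWtensorB ∈ C 0 2 ↔ Bal C [0, 1] := by
  have h := mem_of_toAny_eq (C := C) toAny_singleWtensorB
  rw [← bal_two (C := C) (a := (Sum.inl 0 : ℕ ⊕ ℕ)) (b := Sum.inr 0) (by simp)]
  refine h.trans ⟨fun h => ?_, fun h => hC.mem_of_bal ?_ ?_⟩
  · exact Bal.of_mem (W := [(white, (Sum.inl 0 : ℕ ⊕ ℕ)), (black, Sum.inr 0)]) h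
      (by simp [Color.deg])
  · exact h
  · simp [Color.deg]

theorem exists_toAny_single_tpow (n : ℕ) : ∃ (α : Type) (W : List (Color × α)),
    toAny ((single white).tpow n) = toAny (ofLists [] W) ∧ deg W = n ∧ (letters W).Nodup := by
  induction n with
  | zero => exact ⟨ℕ, [], toAny_ofWord _ _, rfl, List.nodup_nil⟩
  | succ n ih =>
    obtain ⟨α, W, h, hd, hn⟩ := ih
    refine ⟨α ⊕ ℕ, _, toAny_tensor_of_eq h (toAny_ofWord ![white] fun _ => 0), ?_, ?_⟩
    · simp [hd, Color.deg]
    · simp [List.nodup_append, List.nodup_map_iff Sum.inl_injective, hn]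

theorem exists_toAny_pair_tpow (n : ℕ) : ∃ (α : Type) (W : List (Color × α)),
    toAny ((pair white white).tpow n) = toAny (ofLists [] W) ∧ deg W = 2 * n ∧
      ∀ D, IsGlobCategory D → Bal D (letters W) := by
  induction n with
  | zero => exact ⟨ℕ, [], toAny_ofWord _ _, rfl, fun D hD => hD.bal_nil⟩
  | succ n ih =>
    obtain ⟨α, W, h, hd, hb⟩ := ih
    refine ⟨α ⊕ ℕ, _, toAny_tensor_of_eq h (toAny_ofWord ![white, white] fun _ => 0), ?_, ?_⟩
    · simp [hd, Color.deg]; ring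
    · intro D hD
      simpa using hD.bal_sum (hb D hD) (hD.bal_pair 0)

/-! ### Generation in each case -/

theorem even_of_degGroup_eq (hC : IsCategory C) {k : ℕ}
    (hk : degGroup hC = AddSubgroup.zmultiples (k : ℤ))
    (h : ∀ (α : Type) (W : List (Color × α)), Mem C [] W → ¬ Odd W.length) : Even k := by
  obtain ⟨α, W, hW, hd⟩ : (k : ℤ) ∈ degGroup hC := by
    rw [hk]; exact AddSubgroup.mem_zmultiples _
  have := Nat.not_odd_iff_even.1 (h α W hW)
  rw [even_length_iff, hd] at this
  exact_mod_cast this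

theorem isGlobCategory_generated {G : Set AnyColPart} (h : toAny pairWWtensorBB ∈ G) :
    IsGlobCategory (generated G) :=
  { isCategory_generated _ with glob := mem_generated _ (toAny pairWWtensorBB) h }

/-- The cases without singletons. -/
theorem eq_generated_of_no_singleton (hC : IsGlobCategory C) (hN : Noncrossing C)
    (hs : ¬ Bal C [0, 1]) {G : Set AnyColPart} (hG : ∀ g ∈ G, g.2.2 ∈ C g.1 g.2.1)
    (hGg : toAny pairWWtensorBB ∈ G) (h4 : Bal C [0, 0, 0, 0] → Bal (generated G) [0, 0, 0, 0])
    {k : ℕ} (hk : degGroup hC.toIsCategory = AddSubgroup.zmultiples (k : ℤ)) {g : AnyColPart}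
    {Wg : List (Color × γ)} (hg : g = toAny (ofLists [] Wg)) (hd : deg Wg = k)
    (hb : Bal (generated G) (letters Wg)) : C = generated (insert g G) := by
  have hD := isGlobCategory_generated hGg
  have key : ∀ (α : Type) (V : List (Color × α)), Mem C [] V → Bal (generated G) (letters V) :=
    fun α V hV => Part.bal_of_no_singleton hC hN hD hs h4 _ _ rfl (Part.of_mem hC.toIsCategory hV)
  exact eq_generated_insert hC hG hGg hk hg hd
    (fun α β V W hV hW _ => hD.bal_sum (hD.bal_reverse (key _ V hV)) (key _ W hW))
    (fun α V hV _ => hD.bal_sum (hD.bal_reverse (key _ V hV)) hb)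

/-- The cases in which singletons can move freely. -/
theorem eq_generated_of_positioner (hC : IsGlobCategory C) (hN : Noncrossing C)
    {G : Set AnyColPart} (hG : ∀ g ∈ G, g.2.2 ∈ C g.1 g.2.1) (hGg : toAny pairWWtensorBB ∈ G)
    (hs : Bal (generated G) [0, 1]) (hp : Bal (generated G) [0, 1, 2, 1])
    (h4 : Bal C [0, 0, 0, 0] → Bal (generated G) [0, 0, 0, 0]) {k : ℕ}
    (hk : degGroup hC.toIsCategory = AddSubgroup.zmultiples (k : ℤ)) {g : AnyColPart}
    {Wg : List (Color × γ)} (hg : g = toAny (ofLists [] Wg)) (hd : deg Wg = k)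
    (hn : (letters Wg).Nodup) : C = generated (insert g G) := by
  have hD := isGlobCategory_generated hGg
  have h4' : ∀ (α : Type) (V : List (Color × α)), Mem C [] V →
      Bal (generated G) [0, 0, 0, 0] ∨ ∀ a, ¬ [a, a, a].Sublist (letters V) := by
    intro α V hV
    by_cases h : Bal C [0, 0, 0, 0]
    · exact Or.inl (h4 h)
    · exact Or.inr fun a ha =>
        h (Part.bal_four_of_three_sublist hC hN (Part.of_mem hC.toIsCategory hV) ha)
  refine eq_generated_insert hC hG hGg hk hg hd (fun α β V W hV hW hVW => ?_)
    (fun α V hV hVd => ?_)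
  · have h := hC.mem_sum (hC.word_tilde hV) hW
    have he := (hD.bal_of_nc hs hp _ _ rfl (hN.nc h) (h4' _ _ h)).1 (by
      rw [length_letters, even_length_iff]; simp [hVW])
    simpa using he
  · have h := hC.word_tilde hV
    have h' := (word_mapLetters (Sum.inl : α → α ⊕ γ) (by simp)).2 h
    have he := (hD.bal_of_nc hs hp _
      ((letters Wg).map Sum.inr ++ letters (mapLetters (Sum.inl : α → α ⊕ γ) (tilde V))) rfl
      ((hN.nc h').append_of_nodup (hn.map Sum.inr_injective) (by simp)) ?_).1 ?_
    · simpa using hD.bal_rotate he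
    · refine (h4' _ _ h').imp_right fun h3 a ha => ?_
      -- a letter that occurs three times is not a letter of the generator
      obtain ⟨l1, l2, hl, hl1, hl2⟩ := List.sublist_append_iff.1 ha
      have hnd := (hn.map (Sum.inr_injective (α := α))).sublist hl1
      rcases l1 with _ | ⟨x, _ | ⟨y, l1⟩⟩
      · exact h3 a (by rw [show [a, a, a] = l2 from hl]; simpa using hl2)
      · obtain ⟨rfl, rfl⟩ : a = x ∧ [a, a] = l2 := by simpa using hl
        have h5 := hl1.subset (List.mem_singleton_self a)
        have h6 := hl2.subset (List.mem_cons_self)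
        simp at h5 h6
        obtain ⟨_, _, rfl⟩ := h5
        simp at h6
      · simp only [List.cons_append, List.cons.injEq] at hl
        obtain ⟨rfl, rfl, -⟩ := hl
        simp at hnd
    · have : ((letters Wg).map Sum.inr ++ letters (mapLetters (Sum.inl : α → α ⊕ γ) (tilde V))) =
          letters (mapLetters Sum.inr Wg ++ mapLetters (Sum.inl : α → α ⊕ γ) (tilde V)) := by simp
      rw [this, length_letters, even_length_iff]
      simp [hd, hVd]

/-- The case with singletons that cannot move past strings. -/
theorem eq_generated_of_no_positioner (hC : IsGlobCategory C) (hN : Noncrossing C)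
    {G : Set AnyColPart} (hG : ∀ g ∈ G, g.2.2 ∈ C g.1 g.2.1) (hGg : toAny pairWWtensorBB ∈ G)
    (hs : Bal (generated G) [0, 1]) (hp : ¬ Bal C [0, 1, 2, 1]) (h4 : ¬ Bal C [0, 0, 0, 0])
    {k : ℕ} (hk : degGroup hC.toIsCategory = AddSubgroup.zmultiples (k : ℤ)) {g : AnyColPart}
    {Wg : List (Color × γ)} (hg : g = toAny (ofLists [] Wg)) (hd : deg Wg = k)
    (hn : (letters Wg).Nodup) : Even k ∧ C = generated (insert g G) := by
  have hD := isGlobCategory_generated hGg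
  have hodd : ∀ (α : Type) (V : List (Color × α)), Mem C [] V → ¬ Odd V.length :=
    fun α V hV ho => hp (hC.bal_positioner_of_odd hV ho)
  have hke := even_of_degGroup_eq hC.toIsCategory hk hodd
  have key : ∀ (α : Type) (V : List (Color × α)), Mem C [] V → Bal (generated G) (letters V) :=
    fun α V hV => Part.bal_of_no_positioner hC hN hD hs h4 hp _ _ rfl
      (by simpa using hodd α V hV) (Part.of_mem hC.toIsCategory hV)
  have hb : Bal (generated G) (letters Wg) := hD.bal_of_nodup hs (by
    rw [length_letters, even_length_iff, hd]; exact_mod_cast hke) hn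
  exact ⟨hke, eq_generated_insert hC hG hGg hk hg hd
    (fun α β V W hV hW _ => hD.bal_sum (hD.bal_reverse (key _ V hV)) (key _ W hW))
    (fun α V hV _ => hD.bal_sum (hD.bal_reverse (key _ V hV)) hb)⟩

end

end TwoColored

theorem mainTheorem2 (C : Collection) (hC : IsCategory C) (hNC : Noncrossing C)
    (hglob : GloballyColorized C) :
    (CaseO C → ∃ k : ℕ, Even k ∧ C = oGlob k) ∧
    (CaseH C → ∃ k : ℕ, Even k ∧ C = hGlob k) ∧
    (CaseS C → ∃ k : ℕ, C = sGlob k) ∧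
    (CaseB C → (∃ k : ℕ, Even k ∧ C = bGlob k) ∨ (∃ k : ℕ, C = bPrimeGlob k)) := by
  have hC' : IsGlobCategory C := { hC with glob := hglob }
  obtain ⟨k, hk⟩ := exists_degGroup_eq hC
  have hfour : ∀ {G : Set AnyColPart}, toAny ColPart.pairWWtensorBB ∈ G →
      toAny ColPart.fourWBWB ∈ G → Bal (generated G) [0, 0, 0, 0] := fun hg h =>
    (fourWBWB_mem_iff (isGlobCategory_generated hg)).1 (mem_generated _ _ h)
  have hsingle : ∀ {G : Set AnyColPart}, toAny ColPart.pairWWtensorBB ∈ G →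
      toAny ColPart.singleWtensorB ∈ G → Bal (generated G) [0, 1] := fun hg h =>
    (singleWtensorB_mem_iff (isGlobCategory_generated hg)).1 (mem_generated _ _ h)
  have heven : ¬ Bal C [0, 1] → Even k := fun hs =>
    even_of_degGroup_eq hC hk fun α W hW ho => hs (hC'.bal_two_of_odd hW ho)
  refine ⟨fun h => ?_, fun h => ?_, fun h => ?_, fun h => ?_⟩
  · rw [CaseO, singleWtensorB_mem_iff hC', fourWBWB_mem_iff hC'] at h
    have hke := heven h.1
    obtain ⟨α, W, hW, hd, hb⟩ := exists_toAny_pair_tpow (k / 2)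
    have hk2 : 2 * (k / 2) = k := Nat.two_mul_div_two_of_even hke
    exact ⟨k, hke, eq_generated_of_no_singleton hC' hNC h.1
      (by rintro g rfl; exact hglob) (by simp)
      (fun h4 => absurd h4 h.2) hk hW (by rw [hd]; exact_mod_cast hk2)
      (hb _ (isGlobCategory_generated (by simp)))⟩
  · rw [CaseH, singleWtensorB_mem_iff hC'] at h
    have hke := heven h.1
    obtain ⟨n, hn⟩ := hke
    have hD4 := hfour (G := {toAny ColPart.fourWBWB, toAny ColPart.pairWWtensorBB}) (by simp)
      (by simp)
    refine ⟨k, ⟨n, hn⟩, eq_generated_of_no_singleton hC' hNC h.1 ?_ (by simp) (fun _ => hD4) hk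
      (toAny_ofWord _ _) ?_ ?_⟩
    · rintro g (rfl | rfl)
      exacts [h.2, hglob]
    · simp [deg, Color.deg]
    · have := (isGlobCategory_generated (by simp)).bal_replicate_even hD4 0 n
      rw [← hn] at this
      simpa [letters, List.ofFn_const] using this
  · obtain ⟨α, W, hW, hd, hn⟩ := exists_toAny_single_tpow k
    have hD4 := hfour (G := {toAny ColPart.fourWBWB, toAny ColPart.singleWtensorB,
      toAny ColPart.pairWWtensorBB}) (by simp) (by simp)
    have hDs := hsingle (G := {toAny ColPart.fourWBWB, toAny ColPart.singleWtensorB,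
      toAny ColPart.pairWWtensorBB}) (by simp) (by simp)
    refine ⟨k, eq_generated_of_positioner hC' hNC ?_ (by simp) hDs
      ((isGlobCategory_generated (by simp)).bal_positioner_of_four hDs hD4) (fun _ => hD4) hk hW hd
      hn⟩
    rintro g (rfl | rfl | rfl)
    exacts [h.2, h.1, hglob]
  · obtain ⟨α, W, hW, hd, hn⟩ := exists_toAny_single_tpow k
    have h4 : ¬ Bal C [0, 0, 0, 0] := fun h' => h.2 ((fourWBWB_mem_iff hC').2 h')
    by_cases hp : Bal C [0, 1, 2, 1]
    · refine Or.inr ⟨k, eq_generated_of_positioner hC' hNC ?_ (by simp)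
        (hsingle (by simp) (by simp)) ?_ (fun h' => absurd h' h4) hk hW hd hn⟩
      · rintro g (rfl | rfl | rfl)
        exacts [(positionerWWBB_mem_iff hC').2 hp, h.1, hglob]
      · exact (positionerWWBB_mem_iff (isGlobCategory_generated (by simp))).1
          (mem_generated _ (toAny ColPart.positionerWWBB) (by simp))
    · obtain ⟨hke, h'⟩ := eq_generated_of_no_positioner hC' hNC
        (G := {toAny ColPart.singleWtensorB, toAny ColPart.pairWWtensorBB}) (by
          rintro g (rfl | rfl)
          exacts [h.1, hglob]) (by simp) (hsingle (by simp) (by simp)) hp h4 hk hW hd hn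
      exact Or.inl ⟨k, hke, h'⟩
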